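/- Let $n,p\ge 1$ and consider $n$ agents, labelled $1,\dots,n$, on a strongly connected directed graph, where an edge $(i,j)$ means that $j$ can send information to $i$. Let $\mathcal N_i$ consist of $i$ and of all $j$ such that $(i,j)$ is an edge. Let $A=(a_{ij})\in\mathbb R^{n\times n}$ satisfy $a_{ij}>0$ for $j\in\mathcal N_i$, $a_{ij}=0$ for $j\notin\mathcal N_i$, and $\sum_j a_{ij}=1$ for every $i$. Let $f_1,\dots,f_n:\mathbb R^p\to\mathbb R$ be differentiable, and let $s,l>0$ be such that for all $i$ and all $u,v\in\mathbb R^p$ $$f_i(u)-f_i(v)\le\nabla f_i(u)^\top(u-v)-\tfrac s2\|u-v\|_2^2,\qquad \|\nabla f_i(u)-\nabla f_i(v)\|_2\le l\|u-v\|_2 .$$ Then $\sum_i f_i$ has a unique minimizer $x^*\in\mathbb R^p$; put $\mathbf x^*=(x^*,\dots,x^*)\in(\mathbb R^p)^n$. Matrices $B\in\mathbb R^{n\times n}$ act on $\mathbf a=(a_1,\dots,a_n)\in(\mathbb R^p)^n$ by $(B\mathbf a)_i=\sum_j b_{ij}a_j$; $\|\cdot\|_2$ is the Euclidean norm of vectors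 and the corresponding operator norm of matrices. Given a step size $\alpha$ and an arbitrary $\mathbf x_0\in(\mathbb R^p)^n$, the algorithm is $$\mathbf x_{k+1}=A\mathbf x_k-\alpha\mathbf z_k,\qquad Y_{k+1}=AY_k,\qquad \mathbf z_{k+1}=A\mathbf z_k+\widetilde Y_{k+1}^{-1}\nabla\mathbf f_{k+1}-\widetilde Y_k^{-1}\nabla\mathbf f_k,$$ with $Y_0=I_n$ and $\mathbf z_0=\nabla\mathbf f_0$, where $\nabla\mathbf f_k=(\nabla f_1(x_{k,1}),\dots,\nabla f_n(x_{k,n}))$, $\mathbf x_k=(x_{k,1},\dots,x_{k,n})$, and $\widetilde Y_k$ is the diagonal part of $Y_k$. Let $Y_\infty=\lim_k Y_k$, $\tau=\|A-I_n\|_2$, $\epsilon=\|I_n-Y_\infty\|_2$ and $\widetilde y=\sup_k\|\widetilde Y_k^{-1}\|_2$. There is $\gamma_1\in(0,1)$ such that $\|Y_k-Y_\infty\|_2\le T\gamma_1^k$ for some $T>0$ and all $k\ge0$. There are a norm $\|\cdot\|$ on $(\mathbb R^p)^n$ and constants $\sigma\in(0,1)$, $c,d>0$ with $$\|A\mathbf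 a-Y_\infty\mathbf a\|\le\sigma\|\mathbf a-Y_\infty\mathbf a\|,\qquad \|\mathbf a\|_2\le c\|\mathbf a\|,\qquad \|\mathbf a\|\le d\|\mathbf a\|_2\qquad\text{for all }\mathbf a .$$ For any such norm and constants let $\Delta=cd\epsilon\widetilde y\,lns(\tau+1-\sigma)$ and $$\overline\alpha=\min\left\{\frac{\sqrt{\Delta^2+4cd\epsilon\widetilde y\,n^3l^2(l+s)s(1-\sigma)^2}-\Delta}{2cd\epsilon\widetilde y\,n^2l^2(l+s)},\ \frac1{nl}\right\},$$ where the first term is omitted if $\epsilon=0$ (that is, if $n=1$). Then $\overline\alpha>0$. For $\alpha\in(0,\overline\alpha)$ let $\eta=\max(|1-\alpha nl|,|1-\alpha ns|)$ and $$G=\begin{pmatrix}\sigma&0&\alpha\\ \alpha cnl&\eta&0\\ cd\epsilon\widetilde y\,l(\tau+\alpha nl)&\alpha d\epsilon l^2\widetilde y\,n&\sigma+\alpha cd\epsilon l\widetilde y\end{pmatrix}.$$ There is $\gamma_2\in(0,1)$ such that $\|G^k\|_2\le\Gamma_2\gamma_2^k$ for some $\Gamma_2>0$ and all $k\ge0$.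 For any $\gamma_1,\gamma_2\in(0,1)$ with these properties put $\gamma=\max\{\gamma_1,\gamma_2\}<1$. Then, for every $\mathbf x_0$, the sequence $\mathbf x_k$ generated by the algorithm converges linearly to $\mathbf x^*$: for every $\xi>0$ there is $M>0$ such that $$\|\mathbf x_k-\mathbf x^*\|_2\le M(\gamma+\xi)^k\qquad\text{for all }k\ge0 .$$ -/

import Mathlib

open scoped Matrix.Norms.L2Operator

noncomputable section

namespace RowStochasticOpt

/-- A directed graph is strongly connected if every vertex can be reached from every vertex
along directed edges. -/
def StronglyConnected {n : ℕ} (𝒢 : Digraph (Fin n)) : Prop :=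
  ∀ i j : Fin n, Relation.ReflTransGen 𝒢.Adj i j

/-- The in-neighbourhood of agent `i`: the agent `i` itself, and every agent `j` that can send
information to `i`. An edge `(i, j)` means that `j` can send information to `i`. -/
def inNbhd {n : ℕ} (𝒢 : Digraph (Fin n)) (i : Fin n) : Set (Fin n) :=
  {j | j = i ∨ 𝒢.Adj i j}

/-- Row-stochastic weights that are positive exactly on the in-neighbourhoods. -/
structure IsWeightMatrix {n : ℕ} (𝒢 : Digraph (Fin n)) (A : Matrix (Fin n) (Fin n) ℝ) :
    Prop where
  pos : ∀ i j, j ∈ inNbhd 𝒢 i → 0 < A i j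
  zero : ∀ i j, j ∉ inNbhd 𝒢 i → A i j = 0
  row_sum : ∀ i, ∑ j, A i j = 1

/-- Each local cost is differentiable, strongly convex with constant `s`, and has a Lipschitz
continuous gradient with constant `l`. -/
structure IsRegularCost {n p : ℕ} (f : Fin n → EuclideanSpace ℝ (Fin p) → ℝ) (s l : ℝ) :
    Prop where
  s_pos : 0 < s
  l_pos : 0 < l
  differentiable : ∀ i, Differentiable ℝ (f i)
  strongly_convex : ∀ i x₁ x₂,
    f i x₁ - f i x₂ ≤ inner ℝ (gradient (f i) x₁) (x₁ - x₂) - s / 2 * ‖x₁ - x₂‖ ^ 2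
  lipschitz : ∀ i x₁ x₂,
    ‖gradient (f i) x₁ - gradient (f i) x₂‖ ≤ l * ‖x₁ - x₂‖

/-- `xs` is an optimal solution: a global minimizer of `∑ i, f i`. -/
def IsOptimal {n p : ℕ} (f : Fin n → EuclideanSpace ℝ (Fin p) → ℝ)
    (xs : EuclideanSpace ℝ (Fin p)) : Prop :=
  ∀ w, ∑ i, f i xs ≤ ∑ i, f i w

/-- The stacked vectors: one vector of `ℝ^p` per agent. The norm of this type is the Euclidean
norm of `ℝ^(np)`. -/
abbrev Stack (n p : ℕ) : Type := PiLp 2 (fun _ : Fin n => EuclideanSpace ℝ (Fin p))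

/-- The action of an `n × n` matrix on stacked vectors, i.e. of the Kronecker product of the
matrix with the `p × p` identity. -/
def act {n p : ℕ} (B : Matrix (Fin n) (Fin n) ℝ) (x : Stack n p) : Stack n p :=
  WithLp.toLp 2 (fun i => ∑ j, B i j • x j)

/-- The stacked vector all of whose blocks are `w`. -/
def consensus (n : ℕ) {p : ℕ} (w : EuclideanSpace ℝ (Fin p)) : Stack n p :=
  WithLp.toLp 2 (fun _ => w)

/-- The stacked local gradients, each evaluated at the own block of `x`. -/
def gradStack {n p : ℕ} (f : Fin n → EuclideanSpace ℝ (Fin p) → ℝ) (x : Stack n p) :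
    Stack n p :=
  WithLp.toLp 2 (fun i => gradient (f i) (x i))

/-- The matrices `Y_k`: `Y_0` is the identity and `Y_{k+1} = A Y_k`. -/
def Y {n : ℕ} (A : Matrix (Fin n) (Fin n) ℝ) : ℕ → Matrix (Fin n) (Fin n) ℝ
  | 0 => 1
  | k + 1 => A * Y A k

/-- The diagonal part of `Y_k`. -/
def Ydiag {n : ℕ} (A : Matrix (Fin n) (Fin n) ℝ) (k : ℕ) : Matrix (Fin n) (Fin n) ℝ :=
  Matrix.diagonal (Y A k).diag

/-- The limit of `Y_k`. -/
def Yinf {n : ℕ} (A : Matrix (Fin n) (Fin n) ℝ) : Matrix (Fin n) (Fin n) ℝ :=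
  Filter.limUnder Filter.atTop (Y A)

/-- The sequences `x_k`, `z_k` are generated by the algorithm with weights `A` and step size
`α`; the starting point `x_0` is arbitrary. -/
structure IsRun {n p : ℕ} (A : Matrix (Fin n) (Fin n) ℝ)
    (f : Fin n → EuclideanSpace ℝ (Fin p) → ℝ) (α : ℝ) (x z : ℕ → Stack n p) : Prop where
  z_zero : z 0 = gradStack f (x 0)
  x_succ : ∀ k, x (k + 1) = act A (x k) - α • z k
  z_succ : ∀ k, z (k + 1) = act A (z k) + act (Ydiag A (k + 1))⁻¹ (gradStack f (x (k + 1)))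
    - act (Ydiag A k)⁻¹ (gradStack f (x k))

/-- `τ = ‖A - I‖₂`. -/
def tau {n : ℕ} (A : Matrix (Fin n) (Fin n) ℝ) : ℝ := ‖A - 1‖

/-- `ε = ‖I - Y_∞‖₂`. -/
def eps {n : ℕ} (A : Matrix (Fin n) (Fin n) ℝ) : ℝ := ‖1 - Yinf A‖

/-- The supremum over `k` of the 2-norm of the inverse of the diagonal part of `Y_k`. -/
def ytilde {n : ℕ} (A : Matrix (Fin n) (Fin n) ℝ) : ℝ := ⨆ k, ‖(Ydiag A k)⁻¹‖

/-- `N` is a norm on the stacked vectors for which `A` contracts the distance to the average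
by the factor `σ ∈ (0, 1)`, and `c`, `d` compare it with the Euclidean norm. (The field
`norm_le` makes the seminorm `N` a norm.) -/
structure IsAdaptedNorm {n p : ℕ} (A : Matrix (Fin n) (Fin n) ℝ)
    (N : Seminorm ℝ (Stack n p)) (σ c d : ℝ) : Prop where
  σ_pos : 0 < σ
  σ_lt_one : σ < 1
  c_pos : 0 < c
  d_pos : 0 < d
  norm_le : ∀ a, ‖a‖ ≤ c * N a
  le_norm : ∀ a, N a ≤ d * ‖a‖
  contract : ∀ a, N (act A a - act (Yinf A) a) ≤ σ * N (a - act (Yinf A) a)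

/-- `η = max (|1 - α n l|, |1 - α n s|)`. -/
def eta (n : ℕ) (s l α : ℝ) : ℝ := max |1 - α * n * l| |1 - α * n * s|

/-- The `3 × 3` comparison matrix `G`. -/
def G {n : ℕ} (A : Matrix (Fin n) (Fin n) ℝ) (s l σ c d α : ℝ) : Matrix (Fin 3) (Fin 3) ℝ :=
  !![σ, 0, α;
    α * c * n * l, eta n s l α, 0;
    c * d * eps A * ytilde A * l * (tau A + α * n * l), α * d * eps A * l ^ 2 * ytilde A * n,
      σ + α * c * d * eps A * l * ytilde A]

/-- `Δ = c d ε ỹ l n s (τ + 1 - σ)`. -/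
def Delta {n : ℕ} (A : Matrix (Fin n) (Fin n) ℝ) (s l σ c d : ℝ) : ℝ :=
  c * d * eps A * ytilde A * l * n * s * (tau A + 1 - σ)

/-- The upper bound on the step size. In the degenerate case `ε = 0` (a single agent), where the
first term of the minimum has the form `0 / 0`, that term is absent. -/
def alphaBar {n : ℕ} (A : Matrix (Fin n) (Fin n) ℝ) (s l σ c d : ℝ) : ℝ :=
  if eps A = 0 then 1 / (n * l)
  else min
    ((√(Delta A s l σ c d ^ 2
        + 4 * c * d * eps A * ytilde A * n ^ 3 * l ^ 2 * (l + s) * s * (1 - σ) ^ 2)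
      - Delta A s l σ c d) / (2 * c * d * eps A * ytilde A * n ^ 2 * l ^ 2 * (l + s)))
    (1 / (n * l))

/-- `γ₁ ∈ (0, 1)` is a geometric rate of the convergence of `Y_k` to `Y_∞`. -/
def IsMixingRate {n : ℕ} (A : Matrix (Fin n) (Fin n) ℝ) (γ₁ : ℝ) : Prop :=
  0 < γ₁ ∧ γ₁ < 1 ∧ ∃ T : ℝ, 0 < T ∧ ∀ k : ℕ, ‖Y A k - Yinf A‖ ≤ T * γ₁ ^ k

/-- `γ₂ ∈ (0, 1)` is a geometric rate of the decay of the powers of `B`. -/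
def IsPowerRate {m : ℕ} (B : Matrix (Fin m) (Fin m) ℝ) (γ₂ : ℝ) : Prop :=
  0 < γ₂ ∧ γ₂ < 1 ∧ ∃ Γ₂ : ℝ, 0 < Γ₂ ∧ ∀ k : ℕ, ‖B ^ k‖ ≤ Γ₂ * γ₂ ^ k

end RowStochasticOpt

end

/-! The proof is a small-gain argument. Write `Z = Yinf A`. Since `A` is primitive, its powers
converge geometrically to `Z`, whose rows all equal one positive vector `π` with `πA = π`
(`IsWeightMatrix.isConsensusLimit`).

As `Z * A = Z`, the increments of the tracker telescope under `Z`, so `Z z_k` equals `Z * (Ydiag A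
k)⁻¹` applied to the local gradients (`IsRun.act_Yinf_z`). The diagonal entries of `A ^ k` tend to
those of `Z`, so `Z * (Ydiag A k)⁻¹` tends to the all-ones matrix at rate `γ₁`: the rescaling
removes the bias `π`. Hence the average of `x_k` performs, up to consensus errors and a vanishing
perturbation, a gradient step for the sum of the costs, which is a contraction
(`norm_gradient_step_le`).

Three errors are tracked: disagreement of `x`, distance of its average from the optimum,
disagreement of `z`. They satisfy `e (k + 1) ≤ G e k + C γ₁ ^ k (∑ e k + 1)` entrywise
(`exists_errors_recursion`); the `1` is there because the individual gradients need not vanish at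
the optimum. The step-size bound is the positive root of the quadratic which says that the
nonnegative matrix `G` has a positive strict supersolution, so that its powers decay
(`exists_isPowerRate_G`). Unrolling the recursion then gives decay at rate `max γ₁ γ₂`, up to a
subexponential factor that `ξ` absorbs (`exists_le_of_perturbed_recursion`). -/

open Filter Topology

namespace RowStochasticOpt

/-! ### Matrices acting blockwise on stacked vectors -/

section Action

variable {n p : ℕ}

@[simp]
lemma act_apply (B : Matrix (Fin n) (Fin n) ℝ) (x : Stack n p) (i : Fin n) :
    act B x i = ∑ j, B i j • x j := rfl

@[simp]
lemma consensus_apply (w : EuclideanSpace ℝ (Fin p)) (i : Fin n) : consensus n w i = w := rfl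

@[simp]
lemma gradStack_apply (f : Fin n → EuclideanSpace ℝ (Fin p) → ℝ) (x : Stack n p) (i : Fin n) :
    gradStack f x i = gradient (f i) (x i) := rfl

lemma act_add (B : Matrix (Fin n) (Fin n) ℝ) (x y : Stack n p) :
    act B (x + y) = act B x + act B y := by
  ext1 i
  simp [smul_add, Finset.sum_add_distrib]

lemma act_sub (B : Matrix (Fin n) (Fin n) ℝ) (x y : Stack n p) :
    act B (x - y) = act B x - act B y := by
  ext1 i
  simp [smul_sub, Finset.sum_sub_distrib]

lemma act_smul (B : Matrix (Fin n) (Fin n) ℝ) (r : ℝ) (x : Stack n p) :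
    act B (r • x) = r • act B x := by
  ext1 i
  simp only [act_apply, PiLp.smul_apply, Finset.smul_sum]
  exact Finset.sum_congr rfl fun j _ => smul_comm _ _ _

lemma sub_act (B C : Matrix (Fin n) (Fin n) ℝ) (x : Stack n p) :
    act (B - C) x = act B x - act C x := by
  ext1 i
  simp [sub_smul, Finset.sum_sub_distrib]

lemma one_act (x : Stack n p) : act (1 : Matrix (Fin n) (Fin n) ℝ) x = x := by
  ext1 i
  simp [Matrix.one_apply, ite_smul]

lemma mul_act (B C : Matrix (Fin n) (Fin n) ℝ) (x : Stack n p) :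
    act (B * C) x = act B (act C x) := by
  ext1 i
  simp only [act_apply, Matrix.mul_apply, Finset.sum_smul, Finset.smul_sum, mul_smul]
  exact Finset.sum_comm

lemma consensus_sub (v w : EuclideanSpace ℝ (Fin p)) :
    consensus n (v - w) = consensus n v - consensus n w := by
  ext1 i
  simp

lemma norm_act_le (B : Matrix (Fin n) (Fin n) ℝ) (x : Stack n p) :
    ‖act B x‖ ≤ ‖B‖ * ‖x‖ := by
  -- The action does not mix the `p` coordinates: slicing a stack by coordinate reduces the bound to
  -- the operator norm on `ℝ^n`.
  have key (y : Stack n p) :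
      ‖y‖ ^ 2 = ∑ q, ‖(WithLp.toLp 2 fun i => y i q : EuclideanSpace ℝ (Fin n))‖ ^ 2 := by
    simp only [PiLp.norm_sq_eq_of_L2]
    exact Finset.sum_comm
  refine le_of_sq_le_sq ?_ (by positivity)
  rw [mul_pow, key, key, Finset.mul_sum]
  refine Finset.sum_le_sum fun q _ => ?_
  rw [← mul_pow]
  gcongr
  have h := Matrix.l2_opNorm_mulVec B (WithLp.toLp 2 fun i => x i q : EuclideanSpace ℝ (Fin n))
  convert h using 2
  congr 1
  ext i
  simp [Matrix.mulVec, dotProduct]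

lemma norm_consensus (w : EuclideanSpace ℝ (Fin p)) : ‖consensus n w‖ = √n * ‖w‖ := by
  rw [PiLp.norm_eq_of_L2]
  simp

end Action

/-! ### Operator norm versus entries -/

section OperatorNorm

variable {m : ℕ}

lemma abs_entry_le_norm (B : Matrix (Fin m) (Fin m) ℝ) (i j : Fin m) : |B i j| ≤ ‖B‖ := by
  have h := Matrix.l2_opNorm_mulVec B (EuclideanSpace.single j (1 : ℝ))
  have h' := (PiLp.norm_apply_le _ i).trans h
  simpa using h'

lemma exists_norm_le_of_entry_le (m : ℕ) : ∃ C : ℝ, 0 < C ∧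
    ∀ (B : Matrix (Fin m) (Fin m) ℝ) (b : ℝ), 0 ≤ b → (∀ i j, |B i j| ≤ b) → ‖B‖ ≤ C * b := by
  have h0 : 0 ≤ ∑ i : Fin m, ∑ j : Fin m, ‖Matrix.single i j (1 : ℝ)‖ :=
    Finset.sum_nonneg fun i _ => Finset.sum_nonneg fun j _ => norm_nonneg _
  refine ⟨1 + ∑ i : Fin m, ∑ j : Fin m, ‖Matrix.single i j (1 : ℝ)‖, by linarith,
    fun B b hb hB => ?_⟩
  calc ‖B‖ = ‖∑ i, ∑ j, B i j • Matrix.single i j (1 : ℝ)‖ := by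
        conv_lhs => rw [Matrix.matrix_eq_sum_single B]
        simp [Matrix.smul_single]
    _ ≤ ∑ i, ∑ j, ‖B i j • Matrix.single i j (1 : ℝ)‖ :=
        (norm_sum_le _ _).trans (Finset.sum_le_sum fun i _ => norm_sum_le _ _)
    _ ≤ ∑ i, ∑ j, ‖Matrix.single i j (1 : ℝ)‖ * b := by
        refine Finset.sum_le_sum fun i _ => Finset.sum_le_sum fun j _ => ?_
        rw [norm_smul, mul_comm]
        exact mul_le_mul_of_nonneg_left (hB i j) (norm_nonneg _)
    _ ≤ _ := by
        simp only [← Finset.sum_mul]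
        nlinarith

end OperatorNorm

/-! ### Entrywise nonnegative matrices -/

section Nonnegative

variable {m : ℕ} {B : Matrix (Fin m) (Fin m) ℝ}

lemma pow_entry_nonneg (hB : ∀ i j, 0 ≤ B i j) (k : ℕ) (i j : Fin m) : 0 ≤ (B ^ k) i j := by
  induction k generalizing i j with
  | zero => rw [pow_zero, Matrix.one_apply]; split_ifs <;> norm_num
  | succ k ih =>
    rw [pow_succ, Matrix.mul_apply]
    exact Finset.sum_nonneg fun r _ => mul_nonneg (ih i r) (hB r j)

lemma mulVec_mono (hB : ∀ i j, 0 ≤ B i j) {u v : Fin m → ℝ} (h : ∀ j, u j ≤ v j) (i : Fin m) :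
    B.mulVec u i ≤ B.mulVec v i := by
  simp only [Matrix.mulVec, dotProduct]
  exact Finset.sum_le_sum fun j _ => mul_le_mul_of_nonneg_left (h j) (hB i j)

end Nonnegative

/-! ### Contraction of the gradient step -/

section Convex

variable {E : Type*} [NormedAddCommGroup E] [InnerProductSpace ℝ E]

/-- A gradient step contracts distances, for a strongly convex function with Lipschitz gradient. -/
lemma norm_gradient_step_le {F : E → ℝ} {g : E → E} {μ L α : ℝ}
    (hF : ∀ x y, F x - F y ≤ inner ℝ (g x) (x - y) - μ / 2 * ‖x - y‖ ^ 2)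
    (hg : ∀ x y, ‖g x - g y‖ ≤ L * ‖x - y‖) (hα : 0 < α) (hαL : α * L < 1) (x y : E) :
    ‖x - y - α • (g x - g y)‖ ≤ (1 - α * μ) * ‖x - y‖ := by
  rcases eq_or_ne x y with rfl | hxy
  · simp
  -- An upper quadratic bound without integrating along a segment: it costs the constant `L - μ / 2`
  -- instead of `L / 2`, and this loss turns out to be harmless for `α * L < 1`.
  have hupper (a b : E) :
      F a - F b ≤ inner ℝ (g b) (a - b) + (L - μ / 2) * ‖a - b‖ ^ 2 := by
    have h1 : inner ℝ (g a - g b) (a - b) ≤ L * ‖a - b‖ ^ 2 :=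
      (real_inner_le_norm _ _).trans (by nlinarith [hg a b, norm_nonneg (a - b)])
    rw [inner_sub_left] at h1
    linarith [hF a b]
  have hd : 0 < ‖x - y‖ ^ 2 := by have := norm_pos_iff.mpr (sub_ne_zero.mpr hxy); positivity
  have hμL : μ ≤ L := by
    have h1 := hF y x
    have h2 := hupper y x
    have h3 := hF x y
    have h4 := hupper x y
    rw [← neg_sub x y, norm_neg, inner_neg_right] at h1 h2
    by_contra! hlt
    nlinarith
  have hr : 0 < 1 - α * μ := by nlinarith
  set r := 1 - α * μ with hrdef
  set d := x - y with hddef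
  set h := g x - g y - μ • d with hh
  have hgh : g x - g y = h + μ • d := by simp [hh]
  -- The best choice for co-coercivity would be `1 / (2 * (L - μ))`, which is undefined when `L =
  -- μ`; this `t` does not exceed it and suffices.
  set t := α / (2 * r) with ht
  -- Compare `F a` and `F b` through the intermediate point `b + t • v`, with the lower bound at `a`
  -- and the upper bound at `b`. Adding the inequality to its mirror image gives co-coercivity of `g
  -- - μ • id`.
  have hcross (a b : E) (e v : E) (hev : g a - g b = v + μ • e) (he : a - b = e) :
      F b - F a - inner ℝ (g a) (b - a) ≥
        μ / 2 * ‖e‖ ^ 2 + (t - (L - μ) * t ^ 2) * ‖v‖ ^ 2 := by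
    have h1 := hF a (b + t • v)
    have h2 := hupper (b + t • v) b
    have e1 : a - (b + t • v) = e - t • v := by rw [← he]; abel
    have e2 : b + t • v - b = t • v := by abel
    have e3 : b - a = - e := by rw [← he]; abel
    have e4 : inner ℝ (g a) v - inner ℝ (g b) v = ‖v‖ ^ 2 + μ * inner ℝ e v := by
      rw [← inner_sub_left, hev, inner_add_left, real_inner_self_eq_norm_sq, real_inner_smul_left]
    have e5 : ‖e - t • v‖ ^ 2 = ‖e‖ ^ 2 - 2 * t * inner ℝ e v + t ^ 2 * ‖v‖ ^ 2 := by
      rw [norm_sub_sq_real, real_inner_smul_right, norm_smul, mul_pow, Real.norm_eq_abs, sq_abs]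
      ring
    have e6 : ‖t • v‖ ^ 2 = t ^ 2 * ‖v‖ ^ 2 := by
      rw [norm_smul, mul_pow, Real.norm_eq_abs, sq_abs]
    rw [e1, e5, inner_sub_right, real_inner_smul_right] at h1
    rw [e2, e6, real_inner_smul_right] at h2
    rw [e3, inner_neg_right]
    nlinarith [congrArg (fun z => t * z) e4]
  have hc1 := hcross x y d h hgh rfl
  have hc2 := hcross y x (-d) (-h) (by rw [← neg_sub, hgh]; module) (by rw [hddef]; abel)
  have hcoco : 2 * (t - (L - μ) * t ^ 2) * ‖h‖ ^ 2 ≤ inner ℝ h d := by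
    rw [norm_neg, norm_neg, ← hddef] at hc2
    rw [← neg_sub x y, ← hddef, inner_neg_right] at hc1
    have : inner ℝ (g x) d - inner ℝ (g y) d = inner ℝ h d + μ * ‖d‖ ^ 2 := by
      rw [← inner_sub_left, hgh, inner_add_left, real_inner_smul_left, real_inner_self_eq_norm_sq]
    linarith
  -- Exactly what is needed for `‖r • d - α • h‖ ≤ r * ‖d‖` after expanding the square.
  have hfin : α * ‖h‖ ^ 2 ≤ 2 * r * inner ℝ h d := by
    have htr : α ≤ 2 * r * (2 * (t - (L - μ) * t ^ 2)) := by
      have hrt : r * t = α / 2 := by rw [ht]; field_simp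
      have ht0 : 0 < t := by positivity
      have : (L - μ) * α ≤ r := by nlinarith
      have h3 : (L - μ) * t ≤ 1 / 2 := by
        rw [ht, ← mul_div_assoc, div_le_iff₀ (by positivity)]; linarith
      have : 2 * r * (2 * (t - (L - μ) * t ^ 2)) = 4 * (r * t) * (1 - (L - μ) * t) := by ring
      rw [this, hrt]
      nlinarith
    calc α * ‖h‖ ^ 2 ≤ 2 * r * (2 * (t - (L - μ) * t ^ 2)) * ‖h‖ ^ 2 := by gcongr
      _ = 2 * r * (2 * (t - (L - μ) * t ^ 2) * ‖h‖ ^ 2) := by ring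
      _ ≤ _ := by gcongr
  refine le_of_sq_le_sq ?_ (by positivity)
  have e1 : d - α • (g x - g y) = r • d - α • h := by rw [hgh, hrdef]; module
  rw [e1, norm_sub_sq_real, norm_smul, norm_smul, real_inner_smul_left, real_inner_smul_right,
    mul_pow, mul_pow, mul_pow, Real.norm_eq_abs, sq_abs, Real.norm_eq_abs, sq_abs,
    real_inner_comm]
  nlinarith

end Convex

/-! ### Existence and uniqueness of the minimizer -/

section Minimizer

variable {n p : ℕ} {f : Fin n → EuclideanSpace ℝ (Fin p) → ℝ} {s l : ℝ}

lemma IsRegularCost.sum_strongly_convex (hf : IsRegularCost f s l)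
    (x y : EuclideanSpace ℝ (Fin p)) :
    ∑ i, f i x - ∑ i, f i y ≤
      inner ℝ (∑ i, gradient (f i) x) (x - y) - n * s / 2 * ‖x - y‖ ^ 2 := by
  rw [← Finset.sum_sub_distrib, sum_inner]
  refine (Finset.sum_le_sum fun i _ => hf.strongly_convex i x y).trans (le_of_eq ?_)
  rw [Finset.sum_sub_distrib]
  simp
  ring

lemma IsRegularCost.sum_lipschitz (hf : IsRegularCost f s l) (x y : EuclideanSpace ℝ (Fin p)) :
    ‖∑ i, gradient (f i) x - ∑ i, gradient (f i) y‖ ≤ n * l * ‖x - y‖ := by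
  rw [← Finset.sum_sub_distrib]
  refine (norm_sum_le _ _).trans
    ((Finset.sum_le_sum fun i _ => hf.lipschitz i x y).trans (le_of_eq ?_))
  simp
  ring

lemma IsRegularCost.sum_gradient_eq_zero (hf : IsRegularCost f s l)
    {xs : EuclideanSpace ℝ (Fin p)} (hxs : IsOptimal f xs) : ∑ i, gradient (f i) xs = 0 := by
  have h1 : HasFDerivAt (fun x => ∑ i, f i x)
      (∑ i, InnerProductSpace.toDual ℝ _ (gradient (f i) xs)) xs :=
    HasFDerivAt.fun_sum fun i _ => (hf.differentiable i xs).hasGradientAt.hasFDerivAt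
  have h2 : IsLocalMin (fun x => ∑ i, f i x) xs := Eventually.of_forall hxs
  have h3 := h2.hasFDerivAt_eq_zero h1
  rw [← map_sum] at h3
  exact (LinearIsometryEquiv.map_eq_zero_iff _).mp h3

lemma IsRegularCost.existsUnique_isOptimal (hn : 1 ≤ n) (hf : IsRegularCost f s l) :
    ∃! xs, IsOptimal f xs := by
  have hns : 0 < (n : ℝ) * s := mul_pos (by exact_mod_cast hn) hf.s_pos
  have hcont : Continuous fun x => ∑ i, f i x :=
    continuous_finsetSum _ fun i _ => (hf.differentiable i).continuous
  obtain ⟨xs, hxs⟩ : ∃ xs, IsOptimal f xs := by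
    -- Coercivity: beyond radius `2‖v‖ / (n s)` the quadratic term outweighs the linear one, so the
    -- value at `0` is not undercut there.
    refine hcont.exists_forall_le' 0 ?_
    set v := ∑ i, gradient (f i) (0 : EuclideanSpace ℝ (Fin p))
    filter_upwards [tendsto_norm_cocompact_atTop.eventually_ge_atTop (2 * ‖v‖ / (n * s))] with y hy
    have h1 := hf.sum_strongly_convex 0 y
    rw [zero_sub, inner_neg_right, norm_neg] at h1
    have h2 := neg_le_of_abs_le (abs_real_inner_le_norm v y)
    rw [div_le_iff₀ hns] at hy
    nlinarith [norm_nonneg y]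
  refine ⟨xs, hxs, fun y hy => ?_⟩
  have h1 := hf.sum_strongly_convex xs y
  rw [hf.sum_gradient_eq_zero hxs, inner_zero_left] at h1
  have h2 : ‖xs - y‖ ^ 2 ≤ 0 := by
    have := hy xs
    by_contra! h
    nlinarith
  have h3 : ‖xs - y‖ = 0 := by nlinarith [norm_nonneg (xs - y)]
  exact (sub_eq_zero.mp (norm_eq_zero.mp h3)).symm

end Minimizer

/-! ### Geometric decay from periodic contraction -/

section Geometric

/-- An antitone sequence that shrinks by a fixed factor every `m` steps decays geometrically, with
constants that do not depend on the sequence. -/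
lemma exists_geometric_of_step {m : ℕ} (hm : 0 < m) {θ : ℝ} (hθ0 : 0 < θ) (hθ1 : θ < 1) :
    ∃ γ : ℝ, 0 < γ ∧ γ < 1 ∧ ∃ C : ℝ, 0 < C ∧ ∀ b : ℕ → ℝ, Antitone b → 0 ≤ b 0 →
      (∀ k, b (k + m) ≤ θ * b k) → ∀ k, b k ≤ C * b 0 * γ ^ k := by
  set γ := θ ^ (1 / (m : ℝ)) with hγ
  have hm' : (0 : ℝ) < m := by exact_mod_cast hm
  have hγ0 : 0 < γ := Real.rpow_pos_of_pos hθ0 _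
  have hγ1 : γ < 1 := Real.rpow_lt_one hθ0.le hθ1 (by positivity)
  have hγm : γ ^ m = θ := by
    rw [hγ, ← Real.rpow_natCast, ← Real.rpow_mul hθ0.le, one_div_mul_cancel hm'.ne', Real.rpow_one]
  refine ⟨γ, hγ0, hγ1, θ⁻¹, by positivity, fun b hb hb0 hstep k => ?_⟩
  induction k using Nat.strong_induction_on with
  | _ k ih =>
    rcases lt_or_ge k m with hk | hk
    · have h1 : θ ≤ γ ^ k := hγm ▸ pow_le_pow_of_le_one hγ0.le hγ1.le hk.le
      calc b k ≤ b 0 := hb (Nat.zero_le k)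
        _ = θ⁻¹ * b 0 * θ := by field_simp
        _ ≤ θ⁻¹ * b 0 * γ ^ k := by gcongr
    · obtain ⟨r, rfl⟩ := Nat.exists_eq_add_of_le' hk
      calc b (r + m) ≤ θ * b r := hstep r
        _ ≤ θ * (θ⁻¹ * b 0 * γ ^ r) := by
          gcongr
          exact ih r (by omega)
        _ = θ⁻¹ * b 0 * γ ^ (r + m) := by rw [pow_add, hγm]; ring

end Geometric

/-! ### Powers of the weight matrix -/

section Stochastic

variable {n : ℕ}

/-- Doeblin's argument: subtracting `δ` from column `j₀` does not change `w P`, because `w` has zero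
sum, and leaves a nonnegative matrix with row sums `1 - δ`. -/
lemma sum_abs_vecMul_le {P : Matrix (Fin n) (Fin n) ℝ} (hP : ∀ i j, 0 ≤ P i j)
    (hrow : ∀ i, ∑ j, P i j = 1) {j₀ : Fin n} {δ : ℝ} (hδ : ∀ i, δ ≤ P i j₀)
    {w : Fin n → ℝ} (hw : ∑ i, w i = 0) :
    ∑ j, |(Matrix.vecMul w P) j| ≤ (1 - δ) * ∑ i, |w i| := by
  set Q : Fin n → Fin n → ℝ := fun i j => P i j - if j = j₀ then δ else 0 with hQ
  have hQ0 (i j) : 0 ≤ Q i j := by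
    by_cases h : j = j₀
    · subst h; simpa [hQ] using hδ i
    · simpa [hQ, h] using hP i j
  have hQrow (i) : ∑ j, Q i j = 1 - δ := by simp [hQ, Finset.sum_sub_distrib, hrow]
  have hvec (j) : (Matrix.vecMul w P) j = ∑ i, w i * Q i j := by
    simp only [Matrix.vecMul, dotProduct, hQ, mul_sub, Finset.sum_sub_distrib, ← Finset.sum_mul, hw,
      zero_mul, sub_zero]
  calc ∑ j, |(Matrix.vecMul w P) j| ≤ ∑ j, ∑ i, |w i| * Q i j := by
        refine Finset.sum_le_sum fun j _ => ?_
        rw [hvec]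
        refine (Finset.abs_sum_le_sum_abs _ _).trans (le_of_eq ?_)
        exact Finset.sum_congr rfl fun i _ => by rw [abs_mul, abs_of_nonneg (hQ0 i j)]
    _ = (1 - δ) * ∑ i, |w i| := by
        rw [Finset.sum_comm, Finset.mul_sum]
        exact Finset.sum_congr rfl fun i _ => by rw [← Finset.mul_sum, hQrow, mul_comm]

lemma sum_vecMul_of_row_sum {P : Matrix (Fin n) (Fin n) ℝ} (hrow : ∀ i, ∑ j, P i j = 1)
    (w : Fin n → ℝ) : ∑ j, (Matrix.vecMul w P) j = ∑ i, w i := by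
  simp only [Matrix.vecMul, dotProduct]
  rw [Finset.sum_comm]
  exact Finset.sum_congr rfl fun i _ => by rw [← Finset.mul_sum, hrow, mul_one]

variable {𝒢 : Digraph (Fin n)} {A : Matrix (Fin n) (Fin n) ℝ}

lemma Y_eq_pow (A : Matrix (Fin n) (Fin n) ℝ) (k : ℕ) : Y A k = A ^ k := by
  induction k with
  | zero => rfl
  | succ k ih => rw [Y, ih, pow_succ']

lemma IsWeightMatrix.nonneg (hA : IsWeightMatrix 𝒢 A) (i j : Fin n) : 0 ≤ A i j := by
  by_cases h : j ∈ inNbhd 𝒢 i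
  · exact (hA.pos i j h).le
  · exact (hA.zero i j h).ge

lemma IsWeightMatrix.diag_pos (hA : IsWeightMatrix 𝒢 A) (i : Fin n) : 0 < A i i :=
  hA.pos i i (Or.inl rfl)

lemma IsWeightMatrix.pow_nonneg (hA : IsWeightMatrix 𝒢 A) (k : ℕ) (i j : Fin n) :
    0 ≤ (A ^ k) i j :=
  pow_entry_nonneg hA.nonneg k i j

lemma IsWeightMatrix.pow_row_sum (hA : IsWeightMatrix 𝒢 A) (k : ℕ) (i : Fin n) :
    ∑ j, (A ^ k) i j = 1 := by
  induction k generalizing i with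
  | zero => simp [Matrix.one_apply]
  | succ k ih =>
    simp only [pow_succ, Matrix.mul_apply]
    rw [Finset.sum_comm, ← ih i]
    exact Finset.sum_congr rfl fun r _ => by rw [← Finset.mul_sum, hA.row_sum, mul_one]

lemma IsWeightMatrix.pow_succ_pos (hA : IsWeightMatrix 𝒢 A) {k : ℕ} {i j r : Fin n}
    (h : 0 < (A ^ k) i j) (hr : 0 < A j r) : 0 < (A ^ (k + 1)) i r := by
  rw [pow_succ, Matrix.mul_apply]
  exact Finset.sum_pos' (fun r' _ => mul_nonneg (hA.pow_nonneg k i r') (hA.nonneg r' r))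
    ⟨j, Finset.mem_univ _, mul_pos h hr⟩

lemma IsWeightMatrix.pow_pos_of_le (hA : IsWeightMatrix 𝒢 A) {k k' : ℕ} (hk : k ≤ k')
    {i j : Fin n} (h : 0 < (A ^ k) i j) : 0 < (A ^ k') i j := by
  induction k', hk using Nat.le_induction with
  | base => exact h
  | succ k' _ ih => exact hA.pow_succ_pos ih (hA.diag_pos j)

lemma IsWeightMatrix.pow_diag_pos (hA : IsWeightMatrix 𝒢 A) (k : ℕ) (i : Fin n) :
    0 < (A ^ k) i i :=
  hA.pow_pos_of_le (Nat.zero_le k) (by simp)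

/-- The weight matrix of a strongly connected graph is primitive. -/
lemma IsWeightMatrix.exists_pow_pos (hA : IsWeightMatrix 𝒢 A) (h𝒢 : StronglyConnected 𝒢) :
    ∃ m : ℕ, 0 < m ∧ ∀ i j, 0 < (A ^ m) i j := by
  have h (q : Fin n × Fin n) : ∃ k : ℕ, 0 < (A ^ k) q.1 q.2 := by
    obtain ⟨i, j⟩ := q
    change ∃ k : ℕ, 0 < (A ^ k) i j
    induction h𝒢 i j with
    | refl => exact ⟨0, by simp⟩
    | tail _ hadj ih =>
      obtain ⟨k, hk⟩ := ih
      exact ⟨k + 1, hA.pow_succ_pos hk (hA.pos _ _ (Or.inr hadj))⟩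
  choose k hk using h
  -- The positive diagonal keeps positive entries positive in higher powers, so one exponent serves
  -- all pairs.
  refine ⟨Finset.univ.sup k + 1, Nat.succ_pos _, fun i j => hA.pow_pos_of_le ?_ (hk (i, j))⟩
  exact (Finset.le_sup (f := k) (Finset.mem_univ (i, j))).trans (Nat.le_succ _)

/-- Row vectors of zero sum are contracted geometrically by the powers of the weight matrix. -/
lemma IsWeightMatrix.exists_vecMul_pow_le (hA : IsWeightMatrix 𝒢 A) (h𝒢 : StronglyConnected 𝒢)
    (hn : 1 ≤ n) : ∃ γ : ℝ, 0 < γ ∧ γ < 1 ∧ ∃ C : ℝ, 0 < C ∧ ∀ w : Fin n → ℝ, ∑ i, w i = 0 →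
      ∀ k j, |(Matrix.vecMul w (A ^ k)) j| ≤ C * (∑ i, |w i|) * γ ^ k := by
  obtain ⟨m, hm, hpos⟩ := hA.exists_pow_pos h𝒢
  let j₀ : Fin n := ⟨0, hn⟩
  have : Nonempty (Fin n) := ⟨j₀⟩
  obtain ⟨i₀, hi₀⟩ := Finite.exists_min fun i => (A ^ m) i j₀
  -- The cap `1 / 2` keeps the factor `1 - δ` positive; for one agent the entry itself is `1`.
  set δ := min (1 / 2) ((A ^ m) i₀ j₀) with hδ
  have hδ0 : 0 < δ := lt_min (by norm_num) (hpos _ _)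
  have hδ1 : δ ≤ 1 / 2 := min_le_left _ _
  obtain ⟨γ, hγ0, hγ1, C, hC, hgeo⟩ :=
    exists_geometric_of_step hm (θ := 1 - δ) (by linarith) (by linarith)
  refine ⟨γ, hγ0, hγ1, C, hC, fun w hw k j => ?_⟩
  have hsum (k : ℕ) : ∑ i, (Matrix.vecMul w (A ^ k)) i = 0 := by
    rw [sum_vecMul_of_row_sum (hA.pow_row_sum k), hw]
  have hb := hgeo (fun k => ∑ j, |(Matrix.vecMul w (A ^ k)) j|)
    (antitone_nat_of_succ_le fun k => by
      have h := sum_abs_vecMul_le (P := A) hA.nonneg hA.row_sum (j₀ := j₀) (δ := 0)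
        (fun i => hA.nonneg i _) (hsum k)
      rw [Matrix.vecMul_vecMul, ← pow_succ] at h
      simpa using h)
    (Finset.sum_nonneg fun _ _ => abs_nonneg _)
    (fun k => by
      have h := sum_abs_vecMul_le (hA.pow_nonneg m) (hA.pow_row_sum m) (j₀ := j₀) (δ := δ)
        (fun i => (min_le_right _ _).trans (hi₀ i)) (hsum k)
      rwa [Matrix.vecMul_vecMul, ← pow_add] at h) k
  have h0 : ∑ j, |(Matrix.vecMul w (A ^ 0)) j| = ∑ i, |w i| := by simp
  simp only [h0] at hb
  exact (Finset.single_le_sum (f := fun j => |(Matrix.vecMul w (A ^ k)) j|)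
    (fun _ _ => abs_nonneg _) (Finset.mem_univ j)).trans hb

lemma IsMixingRate.tendsto {γ₁ : ℝ} (h : IsMixingRate A γ₁) :
    Tendsto (fun k => A ^ k) atTop (𝓝 (Yinf A)) := by
  obtain ⟨h0, h1, T, -, hT⟩ := h
  rw [tendsto_iff_norm_sub_tendsto_zero]
  refine squeeze_zero (fun _ => norm_nonneg _) (fun k => (Y_eq_pow A k) ▸ hT k) ?_
  simpa using (tendsto_pow_atTop_nhds_zero_of_lt_one h0.le h1).const_mul T

lemma IsWeightMatrix.exists_isMixingRate (hA : IsWeightMatrix 𝒢 A) (h𝒢 : StronglyConnected 𝒢)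
    (hn : 1 ≤ n) : ∃ γ₁, IsMixingRate A γ₁ := by
  obtain ⟨γ, hγ0, hγ1, C, hC, hdecay⟩ := hA.exists_vecMul_pow_le h𝒢 hn
  obtain ⟨K, hK, hnorm⟩ := exists_norm_le_of_entry_le n
  set S := ∑ i, ∑ j, |(A - 1) i j| with hS
  have hS0 : 0 ≤ S := Finset.sum_nonneg fun _ _ => Finset.sum_nonneg fun _ _ => abs_nonneg _
  have hstep (k : ℕ) : dist (A ^ k) (A ^ (k + 1)) ≤ K * (C * S) * γ ^ k := by
    rw [dist_comm, dist_eq_norm, mul_assoc]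
    refine hnorm _ _ (by positivity) fun i j => ?_
    -- The rows of `A - 1` have zero sum, so consecutive powers approach each other geometrically
    -- and form a Cauchy sequence.
    have e : (A ^ (k + 1) - A ^ k) i j = (Matrix.vecMul ((A - 1) i) (A ^ k)) j := by
      rw [pow_succ', ← sub_one_mul]
      rfl
    rw [e]
    refine (hdecay _ ?_ k j).trans ?_
    · simp [Matrix.sub_apply, Finset.sum_sub_distrib, hA.row_sum, Matrix.one_apply]
    · gcongr
      exact Finset.single_le_sum (f := fun i => ∑ j, |(A - 1) i j|)
        (fun _ _ => Finset.sum_nonneg fun _ _ => abs_nonneg _) (Finset.mem_univ i)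
  obtain ⟨L, hL⟩ := cauchySeq_tendsto_of_complete (cauchySeq_of_le_geometric γ _ hγ1 hstep)
  have hY : Yinf A = L := by
    have : Y A = fun k => A ^ k := funext (Y_eq_pow A)
    rw [Yinf, this]
    exact hL.limUnder_eq
  refine ⟨γ, hγ0, hγ1, K * (C * S) / (1 - γ) + 1, ?_, fun k => ?_⟩
  · have : 0 < 1 - γ := by linarith
    positivity
  · rw [Y_eq_pow, hY, ← dist_eq_norm]
    refine (dist_le_of_le_geometric_of_tendsto γ _ hγ1 hstep hL k).trans ?_
    have : 0 < γ ^ k := by positivity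
    rw [mul_div_right_comm]
    nlinarith

/-- The properties of the limit of the powers of a weight matrix. -/
structure IsConsensusLimit (A Z : Matrix (Fin n) (Fin n) ℝ) : Prop where
  tendsto : Tendsto (fun k => A ^ k) atTop (𝓝 Z)
  mul_left : A * Z = Z
  mul_right : Z * A = Z
  mul_self : Z * Z = Z
  row_sum : ∀ i, ∑ j, Z i j = 1
  row_eq : ∀ i i' j, Z i j = Z i' j
  pos : ∀ i j, 0 < Z i j

lemma IsWeightMatrix.isConsensusLimit (hA : IsWeightMatrix 𝒢 A) (h𝒢 : StronglyConnected 𝒢)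
    (hn : 1 ≤ n) : IsConsensusLimit A (Yinf A) := by
  obtain ⟨γ₁, hγ₁⟩ := hA.exists_isMixingRate h𝒢 hn
  have ht := hγ₁.tendsto
  have hentry (i j) : Tendsto (fun k => (A ^ k) i j) atTop (𝓝 (Yinf A i j)) :=
    ((continuous_id.matrix_elem i j).tendsto _).comp ht
  have hleft : A * Yinf A = Yinf A := by
    have h1 := ht.const_mul A
    simp only [← pow_succ'] at h1
    exact tendsto_nhds_unique h1 ((tendsto_add_atTop_iff_nat 1).mpr ht)
  have hright : Yinf A * A = Yinf A := by
    have h1 := ht.mul_const A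
    simp only [← pow_succ] at h1
    exact tendsto_nhds_unique h1 ((tendsto_add_atTop_iff_nat 1).mpr ht)
  have hpow (k : ℕ) : Yinf A * A ^ k = Yinf A := by
    induction k with
    | zero => simp
    | succ k ih => rw [pow_succ, ← mul_assoc, ih, hright]
  have hself : Yinf A * Yinf A = Yinf A := by
    have h1 := ht.const_mul (Yinf A)
    simp only [hpow] at h1
    exact tendsto_nhds_unique h1 tendsto_const_nhds |>.symm ▸ rfl
  have hrow (i) : ∑ j, Yinf A i j = 1 := by
    have h1 := tendsto_finsetSum Finset.univ fun j _ => hentry i j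
    simp only [hA.pow_row_sum] at h1
    exact tendsto_nhds_unique h1 tendsto_const_nhds |>.symm ▸ rfl
  have hnonneg (i j) : 0 ≤ Yinf A i j :=
    ge_of_tendsto' (hentry i j) fun k => hA.pow_nonneg k i j
  refine ⟨ht, hleft, hright, hself, hrow, fun i i' j => ?_, fun i j => ?_⟩
  · obtain ⟨γ, hγ0, hγ1, C, hC, hdecay⟩ := hA.exists_vecMul_pow_le h𝒢 hn
    -- A zero-sum vector whose product with `A ^ k` is the difference of two rows.
    set w : Fin n → ℝ := Pi.single i 1 - Pi.single i' 1 with hw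
    have h1 : Tendsto (fun k => (A ^ k) i j - (A ^ k) i' j) atTop (𝓝 0) := by
      refine squeeze_zero_norm (a := fun k => C * (∑ i, |w i|) * γ ^ k) (fun k => ?_) ?_
      · have h := hdecay w (by simp [hw]) k j
        simpa [hw, Matrix.sub_vecMul] using h
      · simpa using (tendsto_pow_atTop_nhds_zero_of_lt_one hγ0.le hγ1).const_mul
          (C * (∑ i, |w i|))
    exact sub_eq_zero.mp (tendsto_nhds_unique ((hentry i j).sub (hentry i' j)) h1)
  · obtain ⟨m, -, hpos⟩ := hA.exists_pow_pos h𝒢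
    -- Positivity comes from `Z = Z * A ^ m` with `A ^ m` positive and some entry of the row of `Z`
    -- positive.
    rw [← hpow m, Matrix.mul_apply]
    obtain ⟨r, -, hr⟩ : ∃ r ∈ Finset.univ, 0 < Yinf A i r := by
      refine Finset.exists_lt_of_sum_lt (f := fun _ => (0 : ℝ)) ?_
      rw [hrow]; simp
    exact Finset.sum_pos' (fun r _ => mul_nonneg (hnonneg i r) (hA.pow_nonneg m r j))
      ⟨r, Finset.mem_univ _, mul_pos hr (hpos r j)⟩

end Stochastic

/-! ### An adapted norm -/

section AdaptedNorm

variable {n p : ℕ} {A Z : Matrix (Fin n) (Fin n) ℝ}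

lemma IsConsensusLimit.sub_mul_eq_zero (hZ : IsConsensusLimit A Z) : (A - Z) * Z = 0 := by
  rw [sub_mul, hZ.mul_left, hZ.mul_self, sub_self]

lemma IsConsensusLimit.sub_pow_succ (hZ : IsConsensusLimit A Z) (k : ℕ) :
    (A - Z) ^ (k + 1) = A ^ (k + 1) - Z := by
  induction k with
  | zero => simp
  | succ k ih =>
    have h : A ^ (k + 1) * Z = Z := by
      clear ih
      induction k with
      | zero => simp [hZ.mul_left]
      | succ k ih => rw [pow_succ, mul_assoc, hZ.mul_left, ih]
    rw [pow_succ, ih, sub_mul, mul_sub, mul_sub, hZ.mul_right, hZ.mul_self, h, sub_self, sub_zero,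
      ← pow_succ]

/-- The seminorm `a ↦ ∑ k < m, σ⁻ᵏ ‖Bᵏ a‖`. -/
noncomputable def powerSeminorm (p : ℕ) (B : Matrix (Fin n) (Fin n) ℝ) (σ : ℝ) (hσ : 0 ≤ σ)
    (m : ℕ) : Seminorm ℝ (Stack n p) :=
  Seminorm.of (fun a => ∑ k ∈ Finset.range m, (σ ^ k)⁻¹ * ‖act (B ^ k) a‖)
    (fun a b => by
      rw [← Finset.sum_add_distrib]
      refine Finset.sum_le_sum fun k _ => ?_
      rw [← mul_add, act_add]
      have := pow_nonneg hσ k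
      gcongr
      exact norm_add_le _ _)
    (fun r a => by
      rw [Finset.mul_sum]
      refine Finset.sum_congr rfl fun k _ => ?_
      rw [act_smul, norm_smul]
      ring)

lemma powerSeminorm_apply (B : Matrix (Fin n) (Fin n) ℝ) (σ : ℝ) (hσ : 0 ≤ σ) (m : ℕ)
    (a : Stack n p) :
    powerSeminorm p B σ hσ m a = ∑ k ∈ Finset.range m, (σ ^ k)⁻¹ * ‖act (B ^ k) a‖ := rfl

/-- The powers of `B = A - Z` decay faster than `σ ^ k` for `γ₁ < σ < 1`. In the weighted sum of the
`‖B ^ k a‖`, applying `B` shifts each term to the next at the cost of a factor `σ`; the term falling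
off the end is bounded by the first one. -/
lemma IsConsensusLimit.exists_isAdaptedNorm (hZ : IsConsensusLimit A (Yinf A)) {γ₁ : ℝ}
    (hγ : IsMixingRate A γ₁) :
    ∃ (N : Seminorm ℝ (Stack n p)) (σ c d : ℝ), IsAdaptedNorm A N σ c d := by
  obtain ⟨hγ0, hγ1, T, hT0, hT⟩ := hγ
  set σ := (1 + γ₁) / 2 with hσ
  have hσ0 : 0 < σ := by rw [hσ]; linarith
  have hσ1 : σ < 1 := by rw [hσ]; linarith
  have hγσ : γ₁ < σ := by rw [hσ]; linarith
  set B := A - Yinf A with hB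
  obtain ⟨m, hm⟩ : ∃ m : ℕ, T * (γ₁ / σ) ^ (m + 1) ≤ 1 := by
    have h := (tendsto_pow_atTop_nhds_zero_of_lt_one (r := γ₁ / σ) (by positivity)
      ((div_lt_one hσ0).mpr hγσ)).const_mul T
    rw [mul_zero] at h
    exact (((tendsto_add_atTop_iff_nat 1).mpr h).eventually_le_const one_pos).exists
  have hBm (a : Stack n p) : (σ ^ (m + 1))⁻¹ * ‖act (B ^ (m + 1)) a‖ ≤ ‖a‖ := by
    have h1 : ‖B ^ (m + 1)‖ ≤ σ ^ (m + 1) := by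
      rw [hB, hZ.sub_pow_succ, ← Y_eq_pow]
      refine (hT _).trans ?_
      rwa [div_pow, ← mul_div_assoc, div_le_one (by positivity)] at hm
    rw [inv_mul_le_iff₀ (by positivity)]
    exact (norm_act_le _ _).trans (by gcongr)
  have hsum : 0 ≤ ∑ k ∈ Finset.range (m + 1), (σ ^ k)⁻¹ * ‖B ^ k‖ :=
    Finset.sum_nonneg fun k _ => by positivity
  refine ⟨powerSeminorm p B σ hσ0.le (m + 1), σ, 1,
    ∑ k ∈ Finset.range (m + 1), (σ ^ k)⁻¹ * ‖B ^ k‖ + 1, hσ0, hσ1, one_pos, by linarith,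
    fun a => ?_, fun a => ?_, fun a => ?_⟩
  · rw [powerSeminorm_apply, one_mul]
    refine le_trans (le_of_eq ?_) (Finset.single_le_sum
      (f := fun k => (σ ^ k)⁻¹ * ‖act (B ^ k) a‖) (fun k _ => by positivity)
      (Finset.mem_range.mpr (Nat.succ_pos m)))
    simp [one_act]
  · rw [powerSeminorm_apply, add_mul, Finset.sum_mul]
    have : ∑ k ∈ Finset.range (m + 1), (σ ^ k)⁻¹ * ‖act (B ^ k) a‖ ≤
        ∑ k ∈ Finset.range (m + 1), (σ ^ k)⁻¹ * ‖B ^ k‖ * ‖a‖ := by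
      refine Finset.sum_le_sum fun k _ => ?_
      rw [mul_assoc]
      gcongr
      exact norm_act_le _ _
    linarith [norm_nonneg a]
  · set b := a - act (Yinf A) a with hb
    -- Since `B * Z = 0`, `B` sees only the disagreement `b`.
    have e : act A a - act (Yinf A) a = act B b := by
      rw [hb, act_sub, ← mul_act, hB, hZ.sub_mul_eq_zero, sub_act]
      ext1 i
      simp
    rw [e, powerSeminorm_apply, powerSeminorm_apply, Finset.sum_range_succ,
      Finset.sum_range_succ' _ m, mul_add, Finset.mul_sum]
    refine add_le_add (Finset.sum_le_sum fun k _ => le_of_eq ?_) ?_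
    · rw [← mul_act, ← pow_succ, pow_succ σ]
      field_simp
    · rw [← mul_act, ← pow_succ, pow_zero, pow_zero, one_act, inv_one, one_mul]
      calc (σ ^ m)⁻¹ * ‖act (B ^ (m + 1)) b‖
          = σ * ((σ ^ (m + 1))⁻¹ * ‖act (B ^ (m + 1)) b‖) := by rw [pow_succ σ]; field_simp
        _ ≤ σ * ‖b‖ := by gcongr; exact hBm b

end AdaptedNorm

/-! ### The rescaling by the inverse diagonal -/

section DiagonalInverse

variable {n : ℕ} {𝒢 : Digraph (Fin n)} {A : Matrix (Fin n) (Fin n) ℝ}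

lemma IsWeightMatrix.Ydiag_inv (hA : IsWeightMatrix 𝒢 A) (k : ℕ) :
    (Ydiag A k)⁻¹ = Matrix.diagonal fun i => ((A ^ k) i i)⁻¹ := by
  refine Matrix.inv_eq_right_inv ?_
  rw [Ydiag, Matrix.diagonal_mul_diagonal, ← Matrix.diagonal_one]
  congr 1
  ext i
  rw [Matrix.diag_apply, Y_eq_pow, mul_inv_cancel₀ (hA.pow_diag_pos k i).ne']

/-- The diagonal entries converge to positive limits. Without boundedness the real supremum `ytilde`
would take the default value `0` and bound nothing. -/
lemma IsWeightMatrix.bddAbove_norm_Ydiag_inv (hA : IsWeightMatrix 𝒢 A)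
    (hZ : IsConsensusLimit A (Yinf A)) : BddAbove (Set.range fun k => ‖(Ydiag A k)⁻¹‖) := by
  simp only [hA.Ydiag_inv, Matrix.l2_opNorm_diagonal]
  have h : Tendsto (fun k => fun i => ((A ^ k) i i)⁻¹) atTop (𝓝 fun i => (Yinf A i i)⁻¹) :=
    tendsto_pi_nhds.mpr fun i =>
      (((continuous_id.matrix_elem i i).tendsto _).comp hZ.tendsto).inv₀ (hZ.pos i i).ne'
  exact h.norm.bddAbove_range

lemma IsWeightMatrix.norm_Ydiag_inv_le (hA : IsWeightMatrix 𝒢 A)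
    (hZ : IsConsensusLimit A (Yinf A)) (k : ℕ) : ‖(Ydiag A k)⁻¹‖ ≤ ytilde A :=
  le_ciSup (hA.bddAbove_norm_Ydiag_inv hZ) k

lemma IsWeightMatrix.inv_diag_le (hA : IsWeightMatrix 𝒢 A)
    (hZ : IsConsensusLimit A (Yinf A)) (k : ℕ) (i : Fin n) : ((A ^ k) i i)⁻¹ ≤ ytilde A := by
  refine le_trans ?_ (hA.norm_Ydiag_inv_le hZ k)
  rw [hA.Ydiag_inv, Matrix.l2_opNorm_diagonal]
  exact (le_abs_self _).trans (norm_le_pi_norm (fun i => ((A ^ k) i i)⁻¹) i)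

lemma IsWeightMatrix.ytilde_pos (hA : IsWeightMatrix 𝒢 A)
    (hZ : IsConsensusLimit A (Yinf A)) (hn : 1 ≤ n) : 0 < ytilde A :=
  (inv_pos.mpr (hA.pow_diag_pos 0 ⟨0, hn⟩)).trans_le (hA.inv_diag_le hZ 0 ⟨0, hn⟩)

/-- The matrix all of whose entries are one. -/
def allOnes (n : ℕ) : Matrix (Fin n) (Fin n) ℝ := Matrix.of fun _ _ => 1

/-- The rows of `Z` agree, so entry `(i, j)` of the product is `Z j j / (A ^ k) j j`, which tends to
`1`: the weighted average becomes a plain sum. -/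
lemma IsWeightMatrix.exists_Yinf_mul_Ydiag_inv_le (hA : IsWeightMatrix 𝒢 A)
    (hZ : IsConsensusLimit A (Yinf A)) (hn : 1 ≤ n) {γ₁ : ℝ} (hγ : IsMixingRate A γ₁) :
    ∃ C : ℝ, 0 < C ∧ ∀ k, ‖Yinf A * (Ydiag A k)⁻¹ - allOnes n‖ ≤ C * γ₁ ^ k := by
  obtain ⟨hγ0, hγ1, T, hT0, hT⟩ := hγ
  obtain ⟨K, hK, hnorm⟩ := exists_norm_le_of_entry_le n
  have hy := hA.ytilde_pos hZ hn
  refine ⟨K * (T * ytilde A), by positivity, fun k => ?_⟩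
  rw [mul_assoc]
  refine hnorm _ _ (by positivity) fun i j => ?_
  have hpos := hA.pow_diag_pos k j
  have e : (Yinf A * (Ydiag A k)⁻¹ - allOnes n) i j =
      (Yinf A - A ^ k) j j * ((A ^ k) j j)⁻¹ := by
    rw [hA.Ydiag_inv, Matrix.sub_apply, Matrix.mul_diagonal, hZ.row_eq i j j, Matrix.sub_apply,
      sub_mul, mul_inv_cancel₀ hpos.ne']
    rfl
  rw [e, abs_mul, abs_of_pos (inv_pos.mpr hpos)]
  calc |(Yinf A - A ^ k) j j| * ((A ^ k) j j)⁻¹ ≤ (T * γ₁ ^ k) * ytilde A := by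
        gcongr
        · refine (abs_entry_le_norm _ j j).trans ?_
          rw [← norm_neg, neg_sub, ← Y_eq_pow]
          exact hT k
        · exact hA.inv_diag_le hZ k j
    _ = T * ytilde A * γ₁ ^ k := by ring

lemma IsWeightMatrix.exists_Ydiag_inv_sub_le (hA : IsWeightMatrix 𝒢 A)
    (hZ : IsConsensusLimit A (Yinf A)) (hn : 1 ≤ n) {γ₁ : ℝ} (hγ : IsMixingRate A γ₁) :
    ∃ C : ℝ, 0 < C ∧ ∀ k, ‖(Ydiag A (k + 1))⁻¹ - (Ydiag A k)⁻¹‖ ≤ C * γ₁ ^ k := by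
  obtain ⟨hγ0, hγ1, T, hT0, hT⟩ := hγ
  have hy := hA.ytilde_pos hZ hn
  refine ⟨ytilde A * (2 * T) * ytilde A, by positivity, fun k => ?_⟩
  rw [hA.Ydiag_inv, hA.Ydiag_inv, Matrix.diagonal_sub, Matrix.l2_opNorm_diagonal]
  refine (pi_norm_le_iff_of_nonneg (by positivity)).mpr fun i => ?_
  have hp0 := hA.pow_diag_pos k i
  have hp1 := hA.pow_diag_pos (k + 1) i
  have hT' (r : ℕ) : |(A ^ r) i i - Yinf A i i| ≤ T * γ₁ ^ r := by
    rw [← Matrix.sub_apply, ← Y_eq_pow]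
    exact (abs_entry_le_norm _ i i).trans (hT r)
  have hdiff : |(A ^ k) i i - (A ^ (k + 1)) i i| ≤ 2 * T * γ₁ ^ k := by
    have h1 := abs_sub_le ((A ^ k) i i) (Yinf A i i) ((A ^ (k + 1)) i i)
    rw [abs_sub_comm (Yinf A i i)] at h1
    have h2 : T * γ₁ ^ (k + 1) ≤ T * γ₁ ^ k := by
      gcongr 1
      exact pow_le_pow_of_le_one hγ0.le hγ1.le (Nat.le_succ k)
    linarith [hT' k, hT' (k + 1)]
  rw [Real.norm_eq_abs, inv_sub_inv' hp1.ne' hp0.ne', abs_mul, abs_mul,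
    abs_of_pos (inv_pos.mpr hp0), abs_of_pos (inv_pos.mpr hp1)]
  calc _ ≤ ytilde A * (2 * T * γ₁ ^ k) * ytilde A := by
        gcongr
        · exact hA.inv_diag_le hZ _ i
        · exact hA.inv_diag_le hZ _ i
    _ = _ := by ring

end DiagonalInverse

/-! ### Nonnegative matrices and perturbed recursions -/

section Comparison

/-- A nonnegative matrix with a positive strict supersolution has geometrically decaying powers. -/
lemma exists_isPowerRate_of_mulVec_lt {m : ℕ} {B : Matrix (Fin m) (Fin m) ℝ}
    (hm : 0 < m) (hB : ∀ i j, 0 ≤ B i j) {v : Fin m → ℝ} (hv : ∀ i, 0 < v i)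
    (h : ∀ i, (B.mulVec v) i < v i) : ∃ γ₂, IsPowerRate B γ₂ := by
  have : Nonempty (Fin m) := ⟨⟨0, hm⟩⟩
  obtain ⟨i₀, hi₀⟩ := Finite.exists_max fun i => (B.mulVec v) i / v i
  obtain ⟨j₀, hj₀⟩ := Finite.exists_min v
  obtain ⟨j₁, hj₁⟩ := Finite.exists_max v
  obtain ⟨K, hK, hnorm⟩ := exists_norm_le_of_entry_le m
  -- The Collatz–Wielandt ratio of `v`; the `1 / 2` only keeps `θ` positive.
  set θ := max (1 / 2) ((B.mulVec v) i₀ / v i₀) with hθ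
  have hθ0 : 0 < θ := lt_max_of_lt_left (by norm_num)
  have hθ1 : θ < 1 := max_lt (by norm_num) ((div_lt_one (hv _)).mpr (h _))
  have hstep (i) : (B.mulVec v) i ≤ θ * v i := by
    rw [← div_le_iff₀ (hv i)]
    exact (hi₀ i).trans (le_max_right _ _)
  have hpow0 := pow_entry_nonneg hB
  have hpow (k : ℕ) (i) : ((B ^ k).mulVec v) i ≤ θ ^ k * v i := by
    induction k generalizing i with
    | zero => simp
    | succ k ih =>
      rw [pow_succ, ← Matrix.mulVec_mulVec]
      calc ((B ^ k).mulVec (B.mulVec v)) i ≤ ((B ^ k).mulVec (θ • v)) i :=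
            mulVec_mono (hpow0 k) hstep i
        _ = θ * ((B ^ k).mulVec v) i := by rw [Matrix.mulVec_smul]; rfl
        _ ≤ θ * (θ ^ k * v i) := by gcongr; exact ih i
        _ = θ ^ (k + 1) * v i := by ring
  refine ⟨θ, hθ0, hθ1, K * (v j₁ / v j₀), mul_pos hK (div_pos (hv _) (hv _)), fun k => ?_⟩
  have := hv j₀
  have := hv j₁
  rw [mul_assoc]
  refine hnorm _ _ (by positivity) fun i j => ?_
  rw [abs_of_nonneg (hpow0 k i j), div_mul_eq_mul_div, le_div_iff₀ (hv j₀)]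
  calc (B ^ k) i j * v j₀ ≤ (B ^ k) i j * v j := mul_le_mul_of_nonneg_left (hj₀ j) (hpow0 k i j)
    _ ≤ ((B ^ k).mulVec v) i :=
        Finset.single_le_sum (f := fun j => (B ^ k) i j * v j)
          (fun j _ => mul_nonneg (hpow0 k i j) (hv j).le) (Finset.mem_univ j)
    _ ≤ θ ^ k * v i := hpow k i
    _ ≤ θ ^ k * v j₁ := by gcongr; exact hj₁ i
    _ = v j₁ * θ ^ k := mul_comm _ _

/-- Growth factors tending to one geometrically, with a bounded input, give subexponential
growth. -/
lemma exists_le_pow_of_step {w : ℕ → ℝ} {C γ q : ℝ} (hw : ∀ k, 0 ≤ w k) (hC : 0 ≤ C)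
    (hγ0 : 0 ≤ γ) (hγ1 : γ < 1) (hq : 1 < q)
    (hstep : ∀ k, w (k + 1) ≤ (1 + C * γ ^ k) * w k + C) :
    ∃ M : ℝ, 0 < M ∧ ∀ k, w k ≤ M * q ^ k := by
  obtain ⟨K, hK⟩ : ∃ K : ℕ, ∀ k ≥ K, C * γ ^ k ≤ (q - 1) / 2 := by
    have h := (tendsto_pow_atTop_nhds_zero_of_lt_one hγ0 hγ1).const_mul C
    rw [mul_zero] at h
    exact eventually_atTop.mp (h.eventually_le_const (by linarith))
  have hsum : 0 ≤ ∑ r ∈ Finset.range (K + 1), w r := Finset.sum_nonneg fun r _ => hw r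
  -- The first summand covers the times up to `K`. Afterwards half of the gap `q - 1` pays for the
  -- growth factor and, by the second summand, the other half for the input `C`.
  set M := ∑ r ∈ Finset.range (K + 1), w r + 2 * C / (q - 1) + 1 with hM
  have hq1 : 0 < q - 1 := by linarith
  have hdiv : 0 ≤ 2 * C / (q - 1) := by positivity
  have hMC : 2 * C ≤ M * (q - 1) := by
    rw [← div_le_iff₀ hq1]; linarith
  have hM0 : 0 < M := by linarith
  have hqk (k : ℕ) : 1 ≤ q ^ k := one_le_pow₀ hq.le
  refine ⟨M, hM0, fun k => ?_⟩
  rcases le_total k K with hk | hk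
  · have h1 := Finset.single_le_sum (f := w) (fun r _ => hw r)
      (Finset.mem_range.mpr (Nat.lt_succ_of_le hk))
    nlinarith [hqk k]
  · induction k, hk using Nat.le_induction with
    | base =>
      have h1 := Finset.single_le_sum (f := w) (fun r _ => hw r)
        (Finset.mem_range.mpr (Nat.lt_succ_self K))
      nlinarith [hqk K]
    | succ k hk ih =>
      calc w (k + 1) ≤ (1 + C * γ ^ k) * w k + C := hstep k
        _ ≤ (1 + (q - 1) / 2) * (M * q ^ k) + M * (q - 1) / 2 * q ^ k := by
            have h1 := hK k hk
            have h2 : C ≤ M * (q - 1) / 2 * q ^ k := by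
              have := hqk k
              nlinarith [mul_pos hM0 hq1]
            have h3 : (1 + C * γ ^ k) * w k ≤ (1 + (q - 1) / 2) * (M * q ^ k) :=
              mul_le_mul (by linarith) ih (hw k) (by linarith)
            linarith
        _ = M * q ^ (k + 1) := by ring

/-- A nonnegative sequence of vectors that satisfies a linear recursive inequality, with a
perturbation that decays geometrically relative to the sequence, decays geometrically. -/
lemma exists_le_of_perturbed_recursion {m : ℕ} {B : Matrix (Fin m) (Fin m) ℝ}
    (hB : ∀ i j, 0 ≤ B i j) {γ₁ γ₂ C ξ : ℝ} (hγ0 : 0 < γ₁) (hγ1 : γ₁ < 1)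
    (hB2 : IsPowerRate B γ₂) (hC : 0 ≤ C) (hξ : 0 < ξ) {t : ℕ → Fin m → ℝ}
    (ht : ∀ k i, 0 ≤ t k i)
    (hstep : ∀ k i, t (k + 1) i ≤ (B.mulVec (t k)) i + C * γ₁ ^ k * (∑ j, t k j + 1)) :
    ∃ M : ℝ, 0 < M ∧ ∀ k, ∑ i, t k i ≤ M * (max γ₁ γ₂ + ξ) ^ k := by
  obtain ⟨hγ20, hγ21, Γ, hΓ, hpow⟩ := hB2
  set γ := max γ₁ γ₂ with hγ
  have hg0 : 0 < γ := lt_max_of_lt_left hγ0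
  have hg1 : γ < 1 := max_lt hγ1 hγ21
  set e : ℕ → ℝ := fun k => ∑ i, t k i with he
  have he0 (k) : 0 ≤ e k := Finset.sum_nonneg fun i _ => ht k i
  -- Discrete variation of constants; the truncated subtraction is harmless because `r < k`.
  have hunroll (k : ℕ) (i) : t k i ≤ ((B ^ k).mulVec (t 0)) i +
      ∑ r ∈ Finset.range k, ∑ j, (B ^ (k - 1 - r)) i j * (C * γ₁ ^ r * (e r + 1)) := by
    induction k generalizing i with
    | zero => simp
    | succ k ih =>
      have h1 : (B.mulVec (t k)) i ≤ (B.mulVec (((B ^ k).mulVec (t 0)) + fun i =>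
          ∑ r ∈ Finset.range k, ∑ j, (B ^ (k - 1 - r)) i j * (C * γ₁ ^ r * (e r + 1)))) i :=
        mulVec_mono hB ih i
      rw [Matrix.mulVec_add, Pi.add_apply, Matrix.mulVec_mulVec, ← pow_succ'] at h1
      have h2 : (B.mulVec fun i =>
          ∑ r ∈ Finset.range k, ∑ j, (B ^ (k - 1 - r)) i j * (C * γ₁ ^ r * (e r + 1))) i =
          ∑ r ∈ Finset.range k, ∑ j, (B ^ (k - r)) i j * (C * γ₁ ^ r * (e r + 1)) := by
        simp only [Matrix.mulVec, dotProduct, Finset.mul_sum]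
        rw [Finset.sum_comm]
        refine Finset.sum_congr rfl fun r hr => ?_
        rw [Finset.sum_comm]
        refine Finset.sum_congr rfl fun j _ => ?_
        have hr' := Finset.mem_range.mp hr
        rw [show k - r = (k - 1 - r) + 1 by omega, pow_succ', Matrix.mul_apply, Finset.sum_mul]
        exact Finset.sum_congr rfl fun a _ => by ring
      rw [Finset.sum_range_succ]
      have h3 : ∑ j, (B ^ (k + 1 - 1 - k)) i j * (C * γ₁ ^ k * (e k + 1)) =
          C * γ₁ ^ k * (e k + 1) := by
        simp [Matrix.one_apply]
      rw [h3]
      have h4 := hstep k i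
      rw [h2] at h1
      simp only [Nat.add_sub_cancel]
      linarith
  have hentry (k : ℕ) (i j) : (B ^ k) i j ≤ Γ * γ ^ k :=
    (le_abs_self _).trans ((abs_entry_le_norm _ i j).trans ((hpow k).trans (by
      gcongr
      exact le_max_right _ _)))
  -- One factor `m` for each of the sums over `i` and `j`; the division by `γ` because the exponents
  -- `k - 1 - r` and `r` add up to `k - 1`.
  set D := (m : ℝ) ^ 2 * Γ * C / γ with hD
  have hD0 : 0 ≤ D := by positivity
  set w : ℕ → ℝ := fun k => m * Γ * e 0 + D * ∑ r ∈ Finset.range k, (e r + 1) with hw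
  have hsum0 (k : ℕ) : 0 ≤ ∑ r ∈ Finset.range k, (e r + 1) :=
    Finset.sum_nonneg fun r _ => by linarith [he0 r]
  have hw0 (k) : 0 ≤ w k := by
    have := hsum0 k
    have := he0 0
    positivity
  have hew (k : ℕ) : e k ≤ γ ^ k * w k := by
    have hti (i) : t k i ≤ Γ * γ ^ k * e 0 +
        ∑ r ∈ Finset.range k, m * (Γ * C / γ * γ ^ k * (e r + 1)) := by
      refine (hunroll k i).trans (add_le_add ?_ (Finset.sum_le_sum fun r hr => ?_))
      · simp only [Matrix.mulVec, dotProduct, he, Finset.mul_sum]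
        exact Finset.sum_le_sum fun j _ => mul_le_mul_of_nonneg_right (hentry k i j) (ht 0 j)
      · have hr' := Finset.mem_range.mp hr
        have hb (j) : (B ^ (k - 1 - r)) i j * (C * γ₁ ^ r * (e r + 1)) ≤
            Γ * C / γ * γ ^ k * (e r + 1) := by
          have her := he0 r
          calc _ ≤ (Γ * γ ^ (k - 1 - r)) * (C * γ ^ r * (e r + 1)) := by
                gcongr
                · exact hentry _ i j
                · exact le_max_left _ _
            _ = _ := by
                have : γ ^ k = γ ^ (k - 1 - r) * γ ^ r * γ := by
                  rw [← pow_add, ← pow_succ]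
                  congr 1
                  omega
                rw [this]
                field_simp
        refine (Finset.sum_le_sum fun j _ => hb j).trans (le_of_eq ?_)
        simp
    refine (Finset.sum_le_sum fun i _ => hti i).trans (le_of_eq ?_)
    simp only [Finset.sum_const, Finset.card_univ, Fintype.card_fin, nsmul_eq_mul, hw, hD]
    rw [← Finset.mul_sum, ← Finset.mul_sum]
    ring
  have hq : 1 < (γ + ξ) / γ := by rw [lt_div_iff₀ hg0]; linarith
  -- Gronwall step: inserting `e k ≤ γ ^ k * w k` into the increment of `w` bounds the growth factor
  -- by `1 + D * γ ^ k`, so `w` grows subexponentially.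
  obtain ⟨M, hM, hwM⟩ := exists_le_pow_of_step hw0 hD0 hg0.le hg1 hq (fun k => by
    have h1 : w (k + 1) = w k + D * (e k + 1) := by
      simp only [hw, Finset.sum_range_succ]; ring
    rw [h1]
    nlinarith [mul_le_mul_of_nonneg_left (hew k) hD0])
  refine ⟨M, hM, fun k => (hew k).trans ?_⟩
  calc γ ^ k * w k ≤ γ ^ k * (M * ((γ + ξ) / γ) ^ k) := by gcongr; exact hwM k
    _ = M * (γ + ξ) ^ k := by rw [div_pow]; field_simp

end Comparison

/-! ### The step-size bound and the powers of `G` -/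

section StepSize

variable {n p : ℕ} {A : Matrix (Fin n) (Fin n) ℝ} {s l σ c d α : ℝ}

lemma IsRegularCost.s_le_l {f : Fin n → EuclideanSpace ℝ (Fin p) → ℝ} (hn : 1 ≤ n) (hp : 1 ≤ p)
    (hf : IsRegularCost f s l) : s ≤ l := by
  let i : Fin n := ⟨0, hn⟩
  let e : EuclideanSpace ℝ (Fin p) := EuclideanSpace.single ⟨0, hp⟩ 1
  have he : ‖e‖ = 1 := by simp [e]
  have h1 := hf.strongly_convex i e 0
  have h2 := hf.strongly_convex i 0 e
  have h3 := (real_inner_le_norm (gradient (f i) e - gradient (f i) 0) e).trans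
    (mul_le_mul_of_nonneg_right (hf.lipschitz i e 0) (norm_nonneg e))
  rw [sub_zero, he] at h1 h3
  rw [zero_sub, norm_neg, inner_neg_right, he] at h2
  rw [inner_sub_left] at h3
  linarith

lemma alphaBar_pos (hn : 1 ≤ n) (hs : 0 < s) (hl : 0 < l) (hσ : σ < 1) (hc : 0 < c) (hd : 0 < d)
    (hy : 0 < ytilde A) : 0 < alphaBar A s l σ c d := by
  have hn' : (0 : ℝ) < n := by exact_mod_cast hn
  have hσ' : 0 < 1 - σ := by linarith
  unfold alphaBar
  split_ifs with hε
  · positivity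
  · have hε' : 0 < eps A := lt_of_le_of_ne (norm_nonneg _) (Ne.symm hε)
    refine lt_min (div_pos (sub_pos.mpr ?_) (by positivity)) (by positivity)
    refine Real.lt_sqrt_of_sq_lt (lt_add_of_pos_right _ (by positivity))

lemma alphaBar_le (n : ℕ) (A : Matrix (Fin n) (Fin n) ℝ) (s l σ c d : ℝ) :
    alphaBar A s l σ c d ≤ 1 / (n * l) := by
  unfold alphaBar
  split_ifs
  · exact le_rfl
  · exact min_le_right _ _

/-- The step sizes below `alphaBar` lie to the left of the positive root of a quadratic. -/
lemma quadratic_lt_of_lt_alphaBar (hn : 1 ≤ n) (hs : 0 < s) (hl : 0 < l) (hσ : σ < 1) (hc : 0 < c)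
    (hd : 0 < d) (hy : 0 < ytilde A) (hα0 : 0 < α) (hα : α < alphaBar A s l σ c d) :
    c * d * eps A * ytilde A * l * (n * l * (l + s) * α ^ 2 + s * (tau A + 1 - σ) * α) <
      s * (1 - σ) ^ 2 := by
  have hn' : (0 : ℝ) < n := by exact_mod_cast hn
  have hσ' : 0 < 1 - σ := by linarith
  unfold alphaBar at hα
  split_ifs at hα with hε
  · rw [hε]
    simp only [mul_zero, zero_mul]
    positivity
  · have hε' : 0 < eps A := lt_of_le_of_ne (norm_nonneg _) (Ne.symm hε)
    have hτ : 0 ≤ tau A := norm_nonneg _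
    have hτσ : 0 < tau A + 1 - σ := by linarith
    have h1 := hα.trans_le (min_le_left _ _)
    have hΔ : 0 < Delta A s l σ c d := by unfold Delta; positivity
    have hΔ' : Delta A s l σ c d = c * d * eps A * ytilde A * l * n * s * (tau A + 1 - σ) := rfl
    set Q := c * d * eps A * ytilde A * n ^ 2 * l ^ 2 * (l + s) with hQ
    have hQ0 : 0 < Q := by positivity
    set D := Delta A s l σ c d with hD
    have e2 : 2 * c * d * eps A * ytilde A * n ^ 2 * l ^ 2 * (l + s) = 2 * Q := by rw [hQ]; ring
    have e3 : 4 * c * d * eps A * ytilde A * n ^ 3 * l ^ 2 * (l + s) * s * (1 - σ) ^ 2 =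
        4 * Q * (n * s * (1 - σ) ^ 2) := by rw [hQ]; ring
    -- The quadratic formula undone: `(2Qα + D)² < D² + 4Q · n s (1 - σ)²`, from which the square is
    -- expanded.
    rw [e2, e3, lt_div_iff₀ (by positivity), lt_sub_iff_add_lt, Real.lt_sqrt (by positivity)] at h1
    have h2 : Q * α ^ 2 + D * α < n * s * (1 - σ) ^ 2 := by
      refine lt_of_mul_lt_mul_left (a := 4 * Q) ?_ (by positivity)
      linarith
    refine lt_of_mul_lt_mul_left (a := (n : ℝ)) ?_ hn'.le
    calc _ = Q * α ^ 2 + D * α := by rw [hQ, hΔ']; ring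
      _ < _ := h2
      _ = _ := by ring

lemma G_nonneg (hl : 0 ≤ l) (hσ : 0 ≤ σ) (hc : 0 ≤ c) (hd : 0 ≤ d)
    (hy : 0 ≤ ytilde A) (hα : 0 ≤ α) (i j : Fin 3) : 0 ≤ G A s l σ c d α i j := by
  have hε : 0 ≤ eps A := norm_nonneg _
  have hτ : 0 ≤ tau A := norm_nonneg _
  have hη : 0 ≤ eta n s l α := (abs_nonneg _).trans (le_max_left _ _)
  fin_cases i <;> fin_cases j <;> simp [G] <;> positivity

/-- The vector `(s, c l, s (1 - σ) / α)` is fixed by the first two rows of `G`, and the third row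
leaves a slack `S` that is positive by the quadratic inequality. A small shift `δ` passes part of
this slack to the first two rows, giving a strict supersolution. -/
lemma exists_isPowerRate_G (hn : 1 ≤ n) (hs : 0 < s) (hsl : s ≤ l) (hσ0 : 0 < σ) (hσ : σ < 1)
    (hc : 0 < c) (hd : 0 < d) (hy : 0 < ytilde A) (hα0 : 0 < α)
    (hα : α < alphaBar A s l σ c d) : ∃ γ₂, IsPowerRate (G A s l σ c d α) γ₂ := by
  have hl : 0 < l := hs.trans_le hsl
  have hn' : (0 : ℝ) < n := by exact_mod_cast hn
  have hε : 0 ≤ eps A := norm_nonneg _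
  have hτ : 0 ≤ tau A := norm_nonneg _
  have hσ' : 0 < 1 - σ := by linarith
  have hquad := quadratic_lt_of_lt_alphaBar hn hs hl hσ hc hd hy hα0 hα
  have hαl : α * n * l < 1 := by
    have := hα.trans_le (alphaBar_le n A s l σ c d)
    rw [lt_div_iff₀ (by positivity)] at this
    linarith
  have hη : eta n s l α = 1 - α * n * s := by
    have h1 : α * n * s ≤ α * n * l := by gcongr
    rw [eta, abs_of_pos (by linarith), abs_of_pos (by linarith), max_eq_right (by linarith)]
  set κ := d * eps A * ytilde A * l with hκ
  have hκ0 : 0 ≤ κ := by positivity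
  set r := s * (1 - σ) / α with hr
  have hr0 : 0 < r := by positivity
  have hrα : α * r = s * (1 - σ) := by rw [hr]; field_simp
  set S := (1 - σ) * r - (c * κ * (tau A + α * n * l) * s + α * κ * l * n * (c * l)
    + α * c * κ * r) with hS
  have hS0 : 0 < S := by
    refine pos_of_mul_pos_right (a := α) ?_ hα0.le
    have : α * S = s * (1 - σ) ^ 2 - c * d * eps A * ytilde A * l *
        (n * l * (l + s) * α ^ 2 + s * (tau A + 1 - σ) * α) := by
      rw [hS]
      linear_combination ((1 - σ) - α * c * κ) * hrα
    rw [this]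
    linarith
  set ρ := α * κ * l * n + 1 with hρ
  have hρ0 : 0 < ρ := by positivity
  -- The first bound keeps the third row strict, the second keeps `r - δ` positive.
  set δ := min (S / (2 * ρ)) (r / 2) with hδ
  have hδ0 : 0 < δ := by positivity
  have hδr : δ < r := (min_le_right _ _).trans_lt (by linarith)
  have hδS : δ * ρ < S := by
    have h1 : δ * (2 * ρ) ≤ S := by
      rw [← le_div_iff₀ (by positivity)]; exact min_le_left _ _
    nlinarith [mul_pos hδ0 hρ0]
  refine exists_isPowerRate_of_mulVec_lt (by norm_num)
    (G_nonneg hl.le hσ0.le hc.le hd.le hy.le hα0.le) (v := ![s, c * l + δ, r - δ])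
    (fun i => ?_) (fun i => ?_)
  · fin_cases i
    · simpa using hs
    · simp; positivity
    · simpa using hδr
  · fin_cases i <;>
      simp only [Matrix.mulVec, dotProduct, Fin.sum_univ_three, G, hη, Fin.zero_eta, Fin.mk_one,
        Fin.reduceFinMk, Matrix.of_apply, Matrix.cons_val', Matrix.cons_val_zero,
        Matrix.cons_val_one, Matrix.cons_val]
    · have e : σ * s + 0 * (c * l + δ) + α * (r - δ) = s - α * δ := by linear_combination hrα
      rw [e]
      exact sub_lt_self _ (mul_pos hα0 hδ0)
    · have e : α * c * n * l * s + (1 - α * n * s) * (c * l + δ) + 0 * (r - δ) =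
          c * l + δ - α * n * s * δ := by ring
      rw [e]
      exact sub_lt_self _ (by positivity)
    · have h1 : 0 ≤ α * c * κ * δ := by positivity
      have h2 : 0 < σ * δ := by positivity
      have e : c * d * eps A * ytilde A * l * (tau A + α * n * l) * s
          + α * d * eps A * l ^ 2 * ytilde A * n * (c * l + δ)
          + (σ + α * c * d * eps A * l * ytilde A) * (r - δ) =
          r - S + α * κ * l * n * δ - σ * δ - α * c * κ * δ := by
        rw [hS, hκ]; ring
      rw [e]
      have : δ * ρ = α * κ * l * n * δ + δ := by rw [hρ]; ring
      linarith

end StepSize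

/-! ### Error recursion of the algorithm -/

section Recursion

variable {n p : ℕ} {A : Matrix (Fin n) (Fin n) ℝ}
  {f : Fin n → EuclideanSpace ℝ (Fin p) → ℝ} {s l α : ℝ}

lemma IsConsensusLimit.exists_act_eq_consensus {Z : Matrix (Fin n) (Fin n) ℝ}
    (hZ : IsConsensusLimit A Z) (hn : 1 ≤ n) (a : Stack n p) : ∃ w, act Z a = consensus n w := by
  refine ⟨act Z a ⟨0, hn⟩, ?_⟩
  ext1 i
  simp only [act_apply, consensus_apply]
  exact Finset.sum_congr rfl fun j _ => by rw [hZ.row_eq i]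

lemma act_allOnes (a : Stack n p) : act (allOnes n) a = consensus n (∑ j, a j) := by
  ext1 i
  simp [allOnes]

lemma norm_act_allOnes_le (a : Stack n p) : ‖act (allOnes n) a‖ ≤ n * ‖a‖ := by
  rw [act_allOnes, norm_consensus]
  have h1 : ‖∑ j, a j‖ ≤ √n * ‖a‖ := by
    refine le_of_sq_le_sq ?_ (by positivity)
    rw [mul_pow, Real.sq_sqrt (by positivity), PiLp.norm_sq_eq_of_L2 _ a]
    calc ‖∑ j, a j‖ ^ 2 ≤ (∑ j, ‖a j‖) ^ 2 := by gcongr; exact norm_sum_le _ _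
      _ ≤ _ := by simpa using sq_sum_le_card_mul_sum_sq (s := Finset.univ) (f := fun j => ‖a j‖)
  calc √n * ‖∑ j, a j‖ ≤ √n * (√n * ‖a‖) := by gcongr
    _ = n * ‖a‖ := by rw [← mul_assoc, Real.mul_self_sqrt (by positivity)]

lemma IsRegularCost.norm_gradStack_sub_le (hf : IsRegularCost f s l) (x y : Stack n p) :
    ‖gradStack f x - gradStack f y‖ ≤ l * ‖x - y‖ := by
  have hl := hf.l_pos
  refine le_of_sq_le_sq ?_ (by positivity)
  rw [mul_pow, PiLp.norm_sq_eq_of_L2, PiLp.norm_sq_eq_of_L2, Finset.mul_sum]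
  refine Finset.sum_le_sum fun i _ => ?_
  rw [← mul_pow]
  gcongr
  exact hf.lipschitz i _ _

lemma act_allOnes_gradStack_optimal (hf : IsRegularCost f s l) {xs : EuclideanSpace ℝ (Fin p)}
    (hxs : IsOptimal f xs) : act (allOnes n) (gradStack f (consensus n xs)) = 0 := by
  rw [act_allOnes]
  simp only [gradStack_apply, consensus_apply, hf.sum_gradient_eq_zero hxs]
  rfl

/-- The centralized gradient step contracts the distance to the optimum. -/
lemma norm_consensus_gradient_step_le (hf : IsRegularCost f s l) {xs : EuclideanSpace ℝ (Fin p)}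
    (hxs : IsOptimal f xs) (hα : 0 < α) (hαl : α * (n * l) < 1) (w : EuclideanSpace ℝ (Fin p)) :
    ‖consensus n w - consensus n xs - α • act (allOnes n) (gradStack f (consensus n w))‖ ≤
      eta n s l α * ‖consensus n w - consensus n xs‖ := by
  have h1 := norm_gradient_step_le hf.sum_strongly_convex hf.sum_lipschitz hα hαl w xs
  rw [hf.sum_gradient_eq_zero hxs, sub_zero] at h1
  have e : consensus n w - consensus n xs - α • act (allOnes n) (gradStack f (consensus n w)) =
      consensus n (w - xs - α • ∑ i, gradient (f i) w) := by
    rw [act_allOnes]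
    ext1 i
    simp
  rw [e, ← consensus_sub, norm_consensus, norm_consensus]
  have h2 : 1 - α * (n * s) ≤ eta n s l α := by
    rw [← mul_assoc]
    exact (le_abs_self _).trans (le_max_right _ _)
  calc √n * ‖w - xs - α • ∑ i, gradient (f i) w‖ ≤ √n * (eta n s l α * ‖w - xs‖) := by
        gcongr
        exact h1.trans (by gcongr)
    _ = _ := by ring

variable {x z : ℕ → Stack n p}

/-- The average of the gradient trackers is the average of the rescaled gradients. -/
lemma IsRun.act_Yinf_z (hrun : IsRun A f α x z) (hZ : IsConsensusLimit A (Yinf A)) (k : ℕ) :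
    act (Yinf A) (z k) = act (Yinf A * (Ydiag A k)⁻¹) (gradStack f (x k)) := by
  induction k with
  | zero =>
    have : Ydiag A 0 = 1 := by simp [Ydiag, Y]
    rw [hrun.z_zero, this, inv_one, mul_one]
  | succ k ih =>
    rw [hrun.z_succ, act_sub, act_add, ← mul_act, hZ.mul_right, ih, ← mul_act, ← mul_act]
    abel

variable {N : Seminorm ℝ (Stack n p)} {σ c d : ℝ} {xs : EuclideanSpace ℝ (Fin p)}

/-- The errors of a run: disagreement of the iterates, distance of their average from the optimum,
and disagreement of the gradient trackers. -/
noncomputable def errors (A : Matrix (Fin n) (Fin n) ℝ) (N : Seminorm ℝ (Stack n p))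
    (xs : EuclideanSpace ℝ (Fin p)) (x z : ℕ → Stack n p) (k : ℕ) : Fin 3 → ℝ :=
  ![N (x k - act (Yinf A) (x k)), ‖act (Yinf A) (x k) - consensus n xs‖,
    N (z k - act (Yinf A) (z k))]

lemma errors_nonneg (k : ℕ) (i : Fin 3) : 0 ≤ errors A N xs x z k i := by
  fin_cases i
  · exact apply_nonneg N _
  · exact norm_nonneg _
  · exact apply_nonneg N _

lemma norm_sub_consensus_le (hN : IsAdaptedNorm A N σ c d) (k : ℕ) :
    ‖x k - consensus n xs‖ ≤ c * errors A N xs x z k 0 + errors A N xs x z k 1 :=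
  calc ‖x k - consensus n xs‖
      ≤ ‖x k - act (Yinf A) (x k)‖ + ‖act (Yinf A) (x k) - consensus n xs‖ :=
        norm_sub_le_norm_sub_add_norm_sub _ _ _
    _ ≤ _ := add_le_add (hN.norm_le _) le_rfl

lemma errors_succ_zero_le (hrun : IsRun A f α x z) (hZ : IsConsensusLimit A (Yinf A))
    (hN : IsAdaptedNorm A N σ c d) (hα : 0 ≤ α) (k : ℕ) :
    errors A N xs x z (k + 1) 0 ≤ σ * errors A N xs x z k 0 + α * errors A N xs x z k 2 := by
  have e : x (k + 1) - act (Yinf A) (x (k + 1)) =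
      (act A (x k) - act (Yinf A) (x k)) - α • (z k - act (Yinf A) (z k)) := by
    rw [hrun.x_succ, act_sub, act_smul, ← mul_act, hZ.mul_right, smul_sub]
    abel
  change N (x (k + 1) - act (Yinf A) (x (k + 1))) ≤ _
  rw [e]
  refine (map_sub_le_add N _ _).trans (add_le_add (hN.contract _) (le_of_eq ?_))
  rw [map_smul_eq_mul, Real.norm_eq_abs, abs_of_nonneg hα]
  rfl

lemma errors_succ_one_le (hn : 1 ≤ n) (hf : IsRegularCost f s l) (hxs : IsOptimal f xs)
    (hrun : IsRun A f α x z) (hZ : IsConsensusLimit A (Yinf A))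
    (hN : IsAdaptedNorm A N σ c d) (hα : 0 < α) (hαl : α * (n * l) < 1) (k : ℕ) :
    errors A N xs x z (k + 1) 1 ≤ α * c * n * l * errors A N xs x z k 0
      + eta n s l α * errors A N xs x z k 1
      + α * (‖Yinf A * (Ydiag A k)⁻¹ - allOnes n‖ * ‖gradStack f (x k)‖) := by
  set u := act (Yinf A) (x k) with hu
  obtain ⟨w, hw⟩ := hZ.exists_act_eq_consensus hn (x k)
  -- An exact gradient step from the average, plus the error of evaluating gradients at the agents'
  -- own points, plus the error of the rescaling.
  have e : act (Yinf A) (x (k + 1)) - consensus n xs =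
      (u - consensus n xs - α • act (allOnes n) (gradStack f u))
      + α • act (allOnes n) (gradStack f u - gradStack f (x k))
      - α • act (Yinf A * (Ydiag A k)⁻¹ - allOnes n) (gradStack f (x k)) := by
    rw [hrun.x_succ, act_sub, act_smul, ← mul_act, hZ.mul_right, hrun.act_Yinf_z hZ, sub_act,
      act_sub]
    module
  have h1 : ‖u - consensus n xs - α • act (allOnes n) (gradStack f u)‖ ≤
      eta n s l α * ‖u - consensus n xs‖ := by
    rw [hu, hw]
    exact norm_consensus_gradient_step_le hf hxs hα hαl w
  have hl := hf.l_pos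
  have h2 : ‖act (allOnes n) (gradStack f u - gradStack f (x k))‖ ≤
      n * (l * (c * N (x k - u))) := by
    refine (norm_act_allOnes_le _).trans ?_
    gcongr
    refine (hf.norm_gradStack_sub_le _ _).trans ?_
    gcongr
    rw [norm_sub_rev]
    exact hN.norm_le _
  have h3 := norm_act_le (Yinf A * (Ydiag A k)⁻¹ - allOnes n) (gradStack f (x k))
  change ‖act (Yinf A) (x (k + 1)) - consensus n xs‖ ≤ α * c * n * l * N (x k - u)
    + eta n s l α * ‖u - consensus n xs‖ + _
  rw [e]
  refine (norm_sub_le _ _).trans ?_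
  refine (add_le_add (norm_add_le _ _) le_rfl).trans ?_
  rw [norm_smul, norm_smul, Real.norm_eq_abs, abs_of_pos hα]
  have h2' := mul_le_mul_of_nonneg_left h2 hα.le
  have h3' := mul_le_mul_of_nonneg_left h3 hα.le
  linarith

lemma norm_x_succ_sub_le (hf : IsRegularCost f s l) (hxs : IsOptimal f xs)
    (hrun : IsRun A f α x z) (hZ : IsConsensusLimit A (Yinf A))
    (hN : IsAdaptedNorm A N σ c d) (hα : 0 < α) (k : ℕ) :
    ‖x (k + 1) - x k‖ ≤ c * (tau A + α * n * l) * errors A N xs x z k 0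
      + α * n * l * errors A N xs x z k 1 + α * c * errors A N xs x z k 2
      + α * (‖Yinf A * (Ydiag A k)⁻¹ - allOnes n‖ * ‖gradStack f (x k)‖) := by
  have hl := hf.l_pos
  -- `(A - 1) * Z = 0`, so only the disagreement of `x k` is moved by `A - 1`.
  have e : x (k + 1) - x k = act (A - 1) (x k - act (Yinf A) (x k)) - α • z k := by
    rw [hrun.x_succ, act_sub, sub_act, ← mul_act, sub_mul, hZ.mul_left, one_mul, sub_self, one_act]
    have : act (0 : Matrix (Fin n) (Fin n) ℝ) (x k) = 0 := by ext1 i; simp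
    rw [this]
    abel
  have h1 : ‖act (A - 1) (x k - act (Yinf A) (x k))‖ ≤ tau A * (c * errors A N xs x z k 0) := by
    refine (norm_act_le _ _).trans (mul_le_mul_of_nonneg_left (hN.norm_le _) (norm_nonneg _))
  -- The gradients at the optimum sum to zero, so they can be subtracted inside the all-ones term;
  -- this makes `z k` small when the errors are.
  have ez : z k = (z k - act (Yinf A) (z k))
      + (act (allOnes n) (gradStack f (x k) - gradStack f (consensus n xs))
      + act (Yinf A * (Ydiag A k)⁻¹ - allOnes n) (gradStack f (x k))) := by
    rw [act_sub, act_allOnes_gradStack_optimal hf hxs, sub_act, hrun.act_Yinf_z hZ]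
    abel
  have h2 : ‖act (allOnes n) (gradStack f (x k) - gradStack f (consensus n xs))‖ ≤
      n * (l * (c * errors A N xs x z k 0 + errors A N xs x z k 1)) := by
    refine (norm_act_allOnes_le _).trans ?_
    gcongr
    refine (hf.norm_gradStack_sub_le _ _).trans ?_
    gcongr
    exact norm_sub_consensus_le hN k
  have h3 := norm_act_le (Yinf A * (Ydiag A k)⁻¹ - allOnes n) (gradStack f (x k))
  have hz : ‖z k‖ ≤ c * errors A N xs x z k 2
      + (n * (l * (c * errors A N xs x z k 0 + errors A N xs x z k 1))
      + ‖Yinf A * (Ydiag A k)⁻¹ - allOnes n‖ * ‖gradStack f (x k)‖) := by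
    refine (congrArg norm ez).le.trans ?_
    exact (norm_add_le _ _).trans (add_le_add (hN.norm_le _)
      ((norm_add_le _ _).trans (add_le_add h2 h3)))
  rw [e]
  refine (norm_sub_le _ _).trans ?_
  rw [norm_smul, Real.norm_eq_abs, abs_of_pos hα]
  have hz' := mul_le_mul_of_nonneg_left hz hα.le
  linarith

lemma errors_succ_two_le {𝒢 : Digraph (Fin n)} (hA : IsWeightMatrix 𝒢 A) (hn : 1 ≤ n)
    (hf : IsRegularCost f s l)
    (hrun : IsRun A f α x z) (hZ : IsConsensusLimit A (Yinf A))
    (hN : IsAdaptedNorm A N σ c d) (k : ℕ) :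
    errors A N xs x z (k + 1) 2 ≤ σ * errors A N xs x z k 2
      + d * (eps A * (ytilde A * (l * ‖x (k + 1) - x k‖)
      + ‖(Ydiag A (k + 1))⁻¹ - (Ydiag A k)⁻¹‖ * ‖gradStack f (x k)‖)) := by
  have hd := hN.d_pos
  have hy := hA.ytilde_pos hZ hn
  have hε : 0 ≤ eps A := norm_nonneg _
  -- The increment of the tracker, split into the change of the gradients and the change of the
  -- rescaling.
  set q := act (Ydiag A (k + 1))⁻¹ (gradStack f (x (k + 1)) - gradStack f (x k))
    + act ((Ydiag A (k + 1))⁻¹ - (Ydiag A k)⁻¹) (gradStack f (x k)) with hq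
  have e : z (k + 1) - act (Yinf A) (z (k + 1)) =
      (act A (z k) - act (Yinf A) (z k)) + act (1 - Yinf A) q := by
    have : z (k + 1) = act A (z k) + q := by
      rw [hrun.z_succ, hq, act_sub, sub_act]
      abel
    rw [this, act_add, ← mul_act, hZ.mul_right, sub_act, one_act]
    abel
  have h1 : ‖q‖ ≤ ytilde A * (l * ‖x (k + 1) - x k‖)
      + ‖(Ydiag A (k + 1))⁻¹ - (Ydiag A k)⁻¹‖ * ‖gradStack f (x k)‖ := by
    refine (norm_add_le _ _).trans (add_le_add ((norm_act_le _ _).trans ?_) (norm_act_le _ _))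
    gcongr
    · exact hA.norm_Ydiag_inv_le hZ _
    · exact hf.norm_gradStack_sub_le _ _
  change N (z (k + 1) - act (Yinf A) (z (k + 1))) ≤ _
  rw [e]
  refine (map_add_le_add N _ _).trans (add_le_add (hN.contract _) ((hN.le_norm _).trans ?_))
  gcongr
  refine (norm_act_le _ _).trans ?_
  exact mul_le_mul_of_nonneg_left h1 hε

/-- The errors satisfy a linear recursive inequality with matrix `G`, up to a perturbation that
decays at the mixing rate. -/
lemma exists_errors_recursion {𝒢 : Digraph (Fin n)} (hA : IsWeightMatrix 𝒢 A) (hn : 1 ≤ n)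
    (hf : IsRegularCost f s l) (hxs : IsOptimal f xs)
    (hrun : IsRun A f α x z) (hZ : IsConsensusLimit A (Yinf A))
    (hN : IsAdaptedNorm A N σ c d) (hα : 0 < α) (hαl : α * (n * l) < 1) {γ₁ : ℝ}
    (hγ : IsMixingRate A γ₁) :
    ∃ C : ℝ, 0 ≤ C ∧ ∀ k i, errors A N xs x z (k + 1) i ≤
      ((G A s l σ c d α).mulVec (errors A N xs x z k)) i
        + C * γ₁ ^ k * (∑ j, errors A N xs x z k j + 1) := by
  obtain ⟨C₁, hC₁, hbound₁⟩ := hA.exists_Yinf_mul_Ydiag_inv_le hZ hn hγ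
  obtain ⟨C₂, hC₂, hbound₂⟩ := hA.exists_Ydiag_inv_sub_le hZ hn hγ
  have hγ0 : 0 < γ₁ := hγ.1
  have hl := hf.l_pos
  have hc := hN.c_pos
  have hd := hN.d_pos
  have hy := hA.ytilde_pos hZ hn
  have hε : 0 ≤ eps A := norm_nonneg _
  set K := l * c + l + ‖gradStack f (consensus n xs)‖ with hK
  have hK0 : 0 < K := by positivity
  -- The `1` accounts for the gradients at the optimum, of which only the sum is zero.
  have hgrad (k : ℕ) : ‖gradStack f (x k)‖ ≤ K * (∑ j, errors A N xs x z k j + 1) := by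
    have h0 := errors_nonneg (A := A) (N := N) (xs := xs) (x := x) (z := z) k
    have h1 : ‖gradStack f (x k)‖ ≤ l * (c * errors A N xs x z k 0 + errors A N xs x z k 1)
        + ‖gradStack f (consensus n xs)‖ := by
      refine (norm_le_norm_sub_add _ (gradStack f (consensus n xs))).trans ?_
      gcongr
      refine (hf.norm_gradStack_sub_le _ _).trans ?_
      gcongr
      exact norm_sub_consensus_le hN k
    refine h1.trans ?_
    rw [Fin.sum_univ_three, hK]
    have g0 := norm_nonneg (gradStack f (consensus n xs))
    have := mul_nonneg g0 (add_nonneg (add_nonneg (h0 0) (h0 1)) (h0 2))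
    have := mul_nonneg (mul_pos hl hc).le (add_nonneg (add_nonneg (h0 1) (h0 2)) zero_le_one)
    have := mul_nonneg hl.le (add_nonneg (add_nonneg (h0 0) (h0 2)) zero_le_one)
    nlinarith
  -- The perturbation in the third row: the inexact average enters through the increment of `x`, and
  -- the change of the rescaling enters directly.
  set D := d * (eps A * (ytilde A * (l * (α * (C₁ * K))) + C₂ * K)) with hD
  have hD0 : 0 ≤ D := by positivity
  have hαK : 0 ≤ α * (C₁ * K) := by positivity
  refine ⟨α * (C₁ * K) + D, by positivity, fun k i => ?_⟩
  set t := errors A N xs x z k with ht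
  set g := γ₁ ^ k * (∑ j, t j + 1) with hg
  have hg0 : 0 ≤ g := by
    have : 0 ≤ ∑ j, t j := Finset.sum_nonneg fun j _ => errors_nonneg k j
    positivity
  have hb₁ : ‖Yinf A * (Ydiag A k)⁻¹ - allOnes n‖ * ‖gradStack f (x k)‖ ≤ C₁ * K * g := by
    calc _ ≤ (C₁ * γ₁ ^ k) * (K * (∑ j, t j + 1)) :=
          mul_le_mul (hbound₁ k) (hgrad k) (norm_nonneg _) (by positivity)
      _ = C₁ * K * g := by rw [hg]; ring
  have hb₂ : ‖(Ydiag A (k + 1))⁻¹ - (Ydiag A k)⁻¹‖ * ‖gradStack f (x k)‖ ≤ C₂ * K * g := by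
    calc _ ≤ (C₂ * γ₁ ^ k) * (K * (∑ j, t j + 1)) :=
          mul_le_mul (hbound₂ k) (hgrad k) (norm_nonneg _) (by positivity)
      _ = C₂ * K * g := by rw [hg]; ring
  have eg : (α * (C₁ * K) + D) * γ₁ ^ k * (∑ j, t j + 1) = α * (C₁ * K) * g + D * g := by
    rw [hg]; ring
  rw [eg]
  have hαg := mul_nonneg hαK hg0
  have hDg := mul_nonneg hD0 hg0
  fin_cases i <;>
    simp only [Matrix.mulVec, dotProduct, Fin.sum_univ_three, G, Fin.zero_eta, Fin.mk_one,
      Fin.reduceFinMk, Matrix.of_apply, Matrix.cons_val', Matrix.cons_val_zero,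
      Matrix.cons_val_one, Matrix.cons_val]
  · have h := errors_succ_zero_le (xs := xs) hrun hZ hN hα.le k
    rw [← ht] at h
    linarith
  · have h := errors_succ_one_le hn hf hxs hrun hZ hN hα hαl k
    rw [← ht] at h
    have := mul_le_mul_of_nonneg_left hb₁ hα.le
    linarith
  · have h := errors_succ_two_le (xs := xs) hA hn hf hrun hZ hN k
    have hx := norm_x_succ_sub_le hf hxs hrun hZ hN hα k
    rw [← ht] at h hx
    have hx' : ‖x (k + 1) - x k‖ ≤ c * (tau A + α * n * l) * t 0 + α * n * l * t 1
        + α * c * t 2 + α * (C₁ * K * g) :=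
      hx.trans (by gcongr)
    calc errors A N xs x z (k + 1) 2
        ≤ σ * t 2 + d * (eps A * (ytilde A * (l * ‖x (k + 1) - x k‖)
          + ‖(Ydiag A (k + 1))⁻¹ - (Ydiag A k)⁻¹‖ * ‖gradStack f (x k)‖)) := h
      _ ≤ σ * t 2 + d * (eps A * (ytilde A * (l * (c * (tau A + α * n * l) * t 0
          + α * n * l * t 1 + α * c * t 2 + α * (C₁ * K * g))) + C₂ * K * g)) := by gcongr
      _ = c * d * eps A * ytilde A * l * (tau A + α * n * l) * t 0
          + α * d * eps A * l ^ 2 * ytilde A * n * t 1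
          + (σ + α * c * d * eps A * l * ytilde A) * t 2 + D * g := by rw [hD]; ring
      _ ≤ _ := by linarith

end Recursion

end RowStochasticOpt

/-! ### The convergence theorem -/

theorem theorem2 {n p : ℕ} (hn : 1 ≤ n) (hp : 1 ≤ p)
    (𝒢 : Digraph (Fin n)) (h𝒢 : RowStochasticOpt.StronglyConnected 𝒢)
    (A : Matrix (Fin n) (Fin n) ℝ) (hA : RowStochasticOpt.IsWeightMatrix 𝒢 A)
    (f : Fin n → EuclideanSpace ℝ (Fin p) → ℝ) (s l : ℝ)
    (hf : RowStochasticOpt.IsRegularCost f s l) :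
    -- the optimal solution exists and is unique
    (∃! xs, RowStochasticOpt.IsOptimal f xs) ∧
    -- the constants that enter the step-size bound and the rate exist
    (∃ γ₁, RowStochasticOpt.IsMixingRate A γ₁) ∧
    (∃ (N : Seminorm ℝ (RowStochasticOpt.Stack n p)) (σ c d : ℝ),
      RowStochasticOpt.IsAdaptedNorm A N σ c d) ∧
    -- and whichever admissible ones are chosen, the iterates converge linearly
    ∀ (N : Seminorm ℝ (RowStochasticOpt.Stack n p)) (σ c d : ℝ),
      RowStochasticOpt.IsAdaptedNorm A N σ c d →
      0 < RowStochasticOpt.alphaBar A s l σ c d ∧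
      ∀ α : ℝ, 0 < α → α < RowStochasticOpt.alphaBar A s l σ c d →
        (∃ γ₂, RowStochasticOpt.IsPowerRate (RowStochasticOpt.G A s l σ c d α) γ₂) ∧
        ∀ γ₁ γ₂ : ℝ, RowStochasticOpt.IsMixingRate A γ₁ →
          RowStochasticOpt.IsPowerRate (RowStochasticOpt.G A s l σ c d α) γ₂ →
          ∀ x z : ℕ → RowStochasticOpt.Stack n p, RowStochasticOpt.IsRun A f α x z →
          ∀ xs, RowStochasticOpt.IsOptimal f xs →
          ∀ ξ : ℝ, 0 < ξ → ∃ M : ℝ, 0 < M ∧ ∀ k : ℕ,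
            ‖x k - RowStochasticOpt.consensus n xs‖ ≤ M * (max γ₁ γ₂ + ξ) ^ k := by
  have hmix := hA.exists_isMixingRate h𝒢 hn
  have hZ := hA.isConsensusLimit h𝒢 hn
  have hy := hA.ytilde_pos hZ hn
  refine ⟨hf.existsUnique_isOptimal hn, hmix, hZ.exists_isAdaptedNorm hmix.choose_spec,
    fun N σ c d hN => ⟨?_, fun α hα0 hα => ⟨?_, ?_⟩⟩⟩
  · exact RowStochasticOpt.alphaBar_pos hn hf.s_pos hf.l_pos hN.σ_lt_one hN.c_pos hN.d_pos hy
  · exact RowStochasticOpt.exists_isPowerRate_G hn hf.s_pos (hf.s_le_l hn hp) hN.σ_pos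
      hN.σ_lt_one hN.c_pos hN.d_pos hy hα0 hα
  · intro γ₁ γ₂ hγ₁ hγ₂ x z hrun xs hxs ξ hξ
    have hαl : α * (n * l) < 1 := by
      have hn' : (0 : ℝ) < n := by exact_mod_cast hn
      have hl := hf.l_pos
      rw [← lt_div_iff₀ (by positivity)]
      exact hα.trans_le (RowStochasticOpt.alphaBar_le n A s l σ c d)
    have hc := hN.c_pos
    obtain ⟨C, hC, hrec⟩ :=
      RowStochasticOpt.exists_errors_recursion hA hn hf hxs hrun hZ hN hα0 hαl hγ₁
    obtain ⟨M, hM, hdecay⟩ := RowStochasticOpt.exists_le_of_perturbed_recursion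
      (RowStochasticOpt.G_nonneg hf.l_pos.le hN.σ_pos.le hN.c_pos.le hN.d_pos.le hy.le hα0.le)
      hγ₁.1 hγ₁.2.1 hγ₂ hC hξ RowStochasticOpt.errors_nonneg hrec
    refine ⟨(c + 1) * M, by positivity, fun k => ?_⟩
    refine (RowStochasticOpt.norm_sub_consensus_le (z := z) hN k).trans ?_
    have h0 := RowStochasticOpt.errors_nonneg (A := A) (N := N) (xs := xs) (x := x) (z := z) k
    have h1 := hdecay k
    rw [Fin.sum_univ_three] at h1
    calc _ ≤ (c + 1) * (M * (max γ₁ γ₂ + ξ) ^ k) := by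
          have h2 := mul_le_mul_of_nonneg_left h1 (add_pos hc one_pos).le
          nlinarith [h0 0, h0 1, h0 2, mul_nonneg hc.le (h0 1), mul_nonneg hc.le (h0 2)]
      _ = _ := by ring
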